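/- Fix a set $\Sigma$ of effect operations. All terms are well typed and are identified up to renaming of bound variables; $\overline{n}$ denotes the numeral $S^n(Z)$ (in EPCF) or $\mathtt{succ}^n(\mathtt{zero})$ (in ECPS). **EPCF.** Types are $\tau,\rho ::= \mathbf 1\mid \mathbf N\mid \rho\to\tau$. Values and computations are $$V,W ::= \star\mid Z\mid S(V)\mid \lambda x{:}\tau.M\mid x,\qquad M,N ::= V\,W\mid \mathbf{return}\,V\mid \mathbf{let}\ M\Rightarrow x\ \mathbf{in}\ N\mid \mathbf{fix}\,V\mid \mathbf{case}\,V\,\mathbf{in}\,\{Z\Rightarrow M,\,S(x)\Rightarrow N\}\mid \sigma(V;W)\ (\sigma\in\Sigma),$$ with the usual simple typing; in particular $\mathbf{fix}\,V:\tau\to\rho$ if $V:(\tau\to\rho)\to(\tau\to\rho)$, and every $\sigma\in\Sigma$ has arity $\mathbf N\times\alpha^{\mathbf N}\to\alpha$: $\sigma(V;W):\tau$ if $V:\mathbf N$ and $W:\mathbf N\to\tau$. Stacks are $S::=id\mid S\circ(\mathbf{let}\,(-)\Rightarrow x\ \mathbf{in}\ M)$, with $id:\rho\Rightarrow\rho$,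 and $S\circ(\mathbf{let}\,(-)\Rightarrow x\ \mathbf{in}\ M):\tau\Rightarrow\rho$ whenever $x:\tau\vdash M:\tau'$ and $S:\tau'\Rightarrow\rho$. The relation $\rightsquigarrow$ on closed computations is given by $$(\lambda x{:}\tau.M)\,V\rightsquigarrow M[V/x],\qquad \mathbf{fix}\,F\rightsquigarrow\mathbf{return}\,\lambda x{:}\tau.\,\mathbf{let}\ F\,(\lambda y{:}\tau.\,\mathbf{let}\ \mathbf{fix}\,F\Rightarrow z\ \mathbf{in}\ z\,y)\Rightarrow w\ \mathbf{in}\ w\,x,$$ $$\mathbf{case}\,Z\,\mathbf{in}\,\{Z\Rightarrow M,S(x)\Rightarrow N\}\rightsquigarrow M,\qquad \mathbf{case}\,S(V)\,\mathbf{in}\,\{Z\Rightarrow M,S(x)\Rightarrow N\}\rightsquigarrow N[V/x],$$ and the relation $\rightarrowtail$ on closed configurations $(S,M)$, $S:\tau\Rightarrow\rho$, $M:\tau$, by $(S,\mathbf{let}\ N\Rightarrow x\ \mathbf{in}\ M)\rightarrowtail(S\circ(\mathbf{let}\,(-)\Rightarrow x\ \mathbf{in}\ M),N)$; $(S\circ(\mathbf{let}\,(-)\Rightarrow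 x\ \mathbf{in}\ M),\mathbf{return}\,V)\rightarrowtail(S,M[V/x])$; and $(S,M)\rightarrowtail(S,M')$ if $M\rightsquigarrow M'$. **ECPS.** Types are $A::=\neg(A_1,\dots,A_n)\mid\mathtt{nat}\mid\mathtt{unit}$. Values and computations are $$v,w::=\mathtt{zero}\mid\mathtt{succ}(v)\mid\star\mid\lambda(x_1,\dots,x_n){:}(A_1,\dots,A_n).t\mid x,\qquad t,s::=v(w_1,\dots,w_n)\mid(\mu x.v)(\vec w)\mid\sigma(v,x.t)\ (\sigma\in\Sigma)\mid\ \downarrow\ \mid\mathtt{case}\,v\,\mathtt{in}\,\{\mathtt{zero}\Rightarrow t,\ \mathtt{succ}(x)\Rightarrow s\}.$$ Computations have no type; $\lambda(\vec x){:}(\vec A).t:\neg(\vec A)$; in $v(\vec w)$ one has $v:\neg(\vec A)$, $\vec w:\vec A$; in $(\mu x.v)(\vec w)$ one has $x:\neg(\vec A)\vdash v:\neg(\vec A)$, $\vec w:\vec A$; in $\sigma(v,x.t)$ one has $v:\mathtt{nat}$, $x:\mathtt{nat}$. On closed computations, $\longrightarrow$ is given by $$(\lambda(\vec x){:}(\vec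 A).t)(\vec w)\longrightarrow t[\vec w/\vec x],\qquad(\mu x.v)(\vec w)\longrightarrow\bigl(v[(\lambda(\vec y){:}(\vec A).(\mu x.v)(\vec y))/x]\bigr)(\vec w),$$ and the two evident rules for $\mathtt{case}$. **Trees.** An effect tree with leaves in a set $X$ is a possibly infinite tree whose leaves are labelled by $\bot$ or by an element of $X$ and whose inner nodes are labelled $\sigma_m$ ($\sigma\in\Sigma$, $m\in\mathbb N$) and have one child for each natural number. Order these trees by: $tr_1\le tr_2$ iff $tr_1$ is obtained from $tr_2$ by replacing some subtrees by $\bot$. This is an $\omega$-cpo with least element $\bot$. For a closed configuration $(S,M)$ with $S:\tau\Rightarrow\rho$, let $|S,M|=\bigsqcup_n|S,M|_n$, a tree with leaves in the closed values of type $\rho$, where $|S,M|_0=\bot$ and $|S,M|_{n+1}$ is: $V$ if $S=id$, $M=\mathbf{return}\,V$; $|S',M'|_n$ if $(S,M)\rightarrowtail(S',M')$; $\sigma_m(|S,W\,\overline 0|_n,|S,W\,\overline 1|_n,\dots)$ if $M=\sigma(\overline m;W)$; and $\bot$ otherwise. For a closed ECPS computation $t$, let $[\![t]\!]=\bigsqcup_n[\![t]\!]_n$,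 a tree with leaves in $\{\downarrow\}$, where $[\![t]\!]_0=\bot$ and $[\![t]\!]_{n+1}$ is: $[\![s]\!]_n$ if $t\longrightarrow s$; $\sigma_m([\![s[\overline 0/x]]\!]_n,[\![s[\overline 1/x]]\!]_n,\dots)$ if $t=\sigma(\overline m,x.s)$; $\downarrow$ if $t=\,\downarrow$; and $\bot$ otherwise. **CPS translation.** On types, $\mathbf N^*=\mathtt{nat}$, $\mathbf 1^*=\mathtt{unit}$, $(\rho\to\tau)^*=\neg(\rho^*,\neg\tau^*)$. A value $V:\tau$ is translated to a value $V^*:\tau^*$, a computation $M:\tau$ to a value $M^*:\neg\neg\tau^*$, and a stack $S:\tau\Rightarrow\rho$ to a value $S^*:\neg\tau^*$ (environments are translated pointwise): $$Z^*=\mathtt{zero},\quad S(V)^*=\mathtt{succ}(V^*),\quad x^*=x,\quad \star^*=\star,\quad(\lambda x{:}\rho.M)^*=\lambda(x,k){:}(\rho^*,\neg\tau^*).\,M^*\,k\quad(M:\tau),$$ $$(V\,W)^*=\lambda k.\,V^*(W^*,k),\quad(\mathbf{return}\,V)^*=\lambda k.\,k\,V^*,\quad(\mathbf{let}\ M\Rightarrow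 x\ \mathbf{in}\ N)^*=\lambda k.\,M^*\,(\lambda x.\,N^*\,k),$$ $$(\mathbf{case}\,V\,\mathbf{in}\,\{Z\Rightarrow M,S(x)\Rightarrow N\})^*=\lambda k.\,\mathtt{case}\,V^*\,\mathtt{in}\,\{\mathtt{zero}\Rightarrow M^*\,k,\ \mathtt{succ}(x)\Rightarrow N^*\,k\},$$ $$\sigma(V;W)^*=\lambda k.\,\sigma(V^*,x.\,W^*(x,k)),$$ where $k:\neg\tau^*$ if the translated computation has type $\tau$; for $\mathbf{fix}\,F:\tau\to\rho$, $$(\mathbf{fix}\,F)^*=\lambda k.\bigl(\mu x.\,\lambda c.\,c\,(\lambda(x',k').\,(\lambda k''.\,(\lambda l.\,F^*(E,l))\,(\lambda w.\,(\lambda l''.\,w(x',l''))\,k''))\,k')\bigr)\,k,$$ $$E=\lambda(y,l').\,(\lambda p.\,x\,(\lambda z.\,(\lambda p'.\,z(y,p'))\,p))\,l',$$ with $k,c,l:\neg\neg(\tau^*,\neg\rho^*)$, $x:\neg\neg\neg(\tau^*,\neg\rho^*)$, $x',y:\tau^*$, $w,z:\neg(\tau^*,\neg\rho^*)$ and $k',k'',l',l'',p,p':\neg\rho^*$;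 and for stacks, $$id^*=\lambda x{:}\rho^*.\downarrow,\qquad(S\circ(\mathbf{let}\,(-)\Rightarrow x\ \mathbf{in}\ M))^*=\lambda x{:}\tau^*.\,M^*\,S^*.$$ **Theorem.** For all EPCF types $\tau,\rho$, every closed EPCF computation $M:\tau$ and every closed stack $S:\tau\Rightarrow\rho$, $$[\![M^*\,S^*]\!]=|S,M|[\downarrow/l_1,\downarrow/l_2,\dots],$$ where the right-hand side is the tree obtained from $|S,M|$ by replacing every leaf labelled by a value by $\downarrow$, while inner nodes and $\bot$-leaves stay the same. -/

import Mathlib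

universe u v

/-! ## Possibly infinite effect trees -/

/-- Labels of tree positions: a leaf `⊥`, a leaf carrying an element of `X`, or an inner node
`σ_m`, which has one child for every natural number. -/
inductive Label (Sig : Type u) (X : Type v) : Type (max u v)
  | bot : Label Sig X
  | leaf (x : X) : Label Sig X
  | node (σ : Sig) (m : ℕ) : Label Sig X

/-- Possibly infinite trees with leaves labelled by `⊥` or by an element of `X`, and with inner
nodes `σ_m` (`σ ∈ Sig`, `m ∈ ℕ`) having an `ℕ`-indexed family of children. A position is a finite
path from the root, `label p` is the label at position `p`. Paths that run out of the tree (below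
a leaf) get the dummy label `bot`, so that a tree is determined by its `label` function. -/
@[ext]
structure EffTree (Sig : Type u) (X : Type v) : Type (max u v) where
  label : List ℕ → Label Sig X
  below_leaf : ∀ (p : List ℕ) (i : ℕ),
    (∀ (σ : Sig) (m : ℕ), label p ≠ Label.node σ m) → label (p ++ [i]) = Label.bot

namespace EffTree

/-- The one-leaf tree with leaf `x`. -/
def leaf {Sig : Type u} {X : Type v} (x : X) : EffTree Sig X where
  label
    | [] => Label.leaf x
    | _ :: _ => Label.bot
  below_leaf := by
    intro p i _
    cases p <;> rfl

/-- The tree `σ_m(c 0, c 1, …)`. -/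
def node {Sig : Type u} {X : Type v} (σ : Sig) (m : ℕ) (c : ℕ → EffTree Sig X) :
    EffTree Sig X where
  label
    | [] => Label.node σ m
    | i :: p => (c i).label p
  below_leaf := by
    intro p i h
    cases p with
    | nil => exact absurd rfl (h σ m)
    | cons j p => exact (c j).below_leaf p i h

/-- `t₁ ≤ t₂` iff `t₁` is obtained from `t₂` by replacing some subtrees by `⊥`. -/
instance instPartialOrder {Sig : Type u} {X : Type v} : PartialOrder (EffTree Sig X) where
  le t₁ t₂ := ∀ p, t₁.label p = Label.bot ∨ t₁.label p = t₂.label p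
  le_refl _ _ := Or.inr rfl
  le_trans a b c hab hbc p := by
    rcases hab p with h | h
    · exact Or.inl h
    · rw [h]; exact hbc p
  le_antisymm a b hab hba := by
    ext p
    rcases hab p with h | h
    · rcases hba p with h2 | h2
      · rw [h, h2]
      · exact h2.symm
    · exact h

theorem le_def {Sig : Type u} {X : Type v} {t₁ t₂ : EffTree Sig X} :
    t₁ ≤ t₂ ↔ ∀ p, t₁.label p = Label.bot ∨ t₁.label p = t₂.label p := Iff.rfl

/-- The tree `⊥`. -/
instance instOrderBot {Sig : Type u} {X : Type v} : OrderBot (EffTree Sig X) where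
  bot := { label := fun _ => Label.bot, below_leaf := fun _ _ _ => rfl }
  bot_le _ _ := Or.inl rfl

theorem chain_label {Sig : Type u} {X : Type v}
    (c : OmegaCompletePartialOrder.Chain (EffTree Sig X)) (p : List ℕ) {m n : ℕ}
    (hm : (c m).label p ≠ Label.bot) (hn : (c n).label p ≠ Label.bot) :
    (c m).label p = (c n).label p := by
  rcases le_total m n with h | h
  · exact ((c.monotone h) p).resolve_left hm
  · exact (((c.monotone h) p).resolve_left hn).symm

open Classical in
/-- The least upper bound of an increasing chain: at every position, the label that the members
of the chain eventually have there. -/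
noncomputable def chainSup {Sig : Type u} {X : Type v}
    (c : OmegaCompletePartialOrder.Chain (EffTree Sig X)) : EffTree Sig X where
  label p := if h : ∃ n, (c n).label p ≠ Label.bot then (c h.choose).label p else Label.bot
  below_leaf := by
    intro p i hp
    split_ifs with h
    · exfalso
      obtain ⟨n, hn⟩ := h
      have h1 : ∃ σ m, (c n).label p = Label.node σ m := by
        by_contra hcon
        push Not at hcon
        exact hn ((c n).below_leaf p i hcon)
      obtain ⟨σ, m, h1⟩ := h1
      have h2 : ∃ n, (c n).label p ≠ Label.bot := ⟨n, by simp [h1]⟩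
      apply hp σ m
      rw [dif_pos h2, ← h1]
      exact chain_label c p h2.choose_spec (by simp [h1])
    · rfl

open Classical in
noncomputable instance instOmegaCompletePartialOrder {Sig : Type u} {X : Type v} :
    OmegaCompletePartialOrder (EffTree Sig X) where
  ωSup := chainSup
  le_ωSup c n p := by
    by_cases h : (c n).label p = Label.bot
    · exact Or.inl h
    · refine Or.inr ?_
      have h2 : ∃ n, (c n).label p ≠ Label.bot := ⟨n, h⟩
      change _ = dite _ _ _
      rw [dif_pos h2]
      exact chain_label c p h h2.choose_spec
  ωSup_le c t ht p := by
    change dite _ _ _ = _ ∨ dite _ _ _ = _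
    by_cases h2 : ∃ n, (c n).label p ≠ Label.bot
    · rw [dif_pos h2]
      exact ht _ p
    · rw [dif_neg h2]
      exact Or.inl rfl

theorem node_mono {Sig : Type u} {X : Type v} (σ : Sig) (m : ℕ) {c d : ℕ → EffTree Sig X}
    (h : ∀ i, c i ≤ d i) : node σ m c ≤ node σ m d := by
  intro p
  cases p with
  | nil => exact Or.inr rfl
  | cons i p => exact h i p

/-- Replace every leaf `x ∈ X` by the leaf `f x`; inner nodes and `⊥`-leaves stay the same. -/
def mapLeaves {Sig : Type u} {X : Type v} {Y : Type v} (f : X → Y) (t : EffTree Sig X) :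
    EffTree Sig Y where
  label p :=
    match t.label p with
    | Label.bot => Label.bot
    | Label.leaf x => Label.leaf (f x)
    | Label.node σ m => Label.node σ m
  below_leaf := by
    intro p i h
    rw [t.below_leaf p i]
    intro σ m hm
    apply h σ m
    rw [hm]

end EffTree

/-! ## Typed de Bruijn variables

Terms are considered up to renaming of bound variables, so we use well-typed de Bruijn terms.
An environment is the list of the types of its variables, the most recent one first. -/

/-- `TVar Γ A` is the type of variables of type `A` in the environment `Γ`. -/
inductive TVar {T : Type} : List T → T → Type
  | here {Γ : List T} {A : T} : TVar (A :: Γ) A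
  | there {Γ : List T} {A B : T} (x : TVar Γ A) : TVar (B :: Γ) A

/-- Renamings. -/
def Ren {T : Type} (Γ Δ : List T) : Type := ∀ A : T, TVar Γ A → TVar Δ A

namespace Ren

/-- Extend a renaming under one binder. -/
def lift {T : Type} {Γ Δ : List T} (r : Ren Γ Δ) (B : T) : Ren (B :: Γ) (B :: Δ)
  | _, TVar.here => TVar.here
  | _, TVar.there x => TVar.there (r _ x)

/-- Extend a renaming under several binders. -/
def lifts {T : Type} {Γ Δ : List T} (r : Ren Γ Δ) : (Bs : List T) → Ren (Bs ++ Γ) (Bs ++ Δ)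
  | [] => r
  | B :: Bs => (r.lifts Bs).lift B

/-- Weakening by several variables. -/
def wk {T : Type} {Γ : List T} : (Bs : List T) → Ren Γ (Bs ++ Γ)
  | [] => fun _ x => x
  | _ :: Bs => fun A x => TVar.there (wk Bs A x)

end Ren

/-! ## EPCF -/

namespace EPCF

inductive Ty : Type
  | unit : Ty
  | nat : Ty
  | arr (ρ τ : Ty) : Ty

mutual

/-- Values `Γ ⊢ V : τ`. -/
inductive Val (Sig : Type u) : List Ty → Ty → Type u
  | var {Γ : List Ty} {τ : Ty} (x : TVar Γ τ) : Val Sig Γ τ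
  | star {Γ : List Ty} : Val Sig Γ Ty.unit
  | zero {Γ : List Ty} : Val Sig Γ Ty.nat
  | succ {Γ : List Ty} (V : Val Sig Γ Ty.nat) : Val Sig Γ Ty.nat
  | lam {Γ : List Ty} {ρ τ : Ty} (M : Comp Sig (ρ :: Γ) τ) : Val Sig Γ (Ty.arr ρ τ)

/-- Computations `Γ ⊢ M : τ`. All effect operations have arity `ℕ × α^ℕ → α`. -/
inductive Comp (Sig : Type u) : List Ty → Ty → Type u
  | app {Γ : List Ty} {ρ τ : Ty} (V : Val Sig Γ (Ty.arr ρ τ)) (W : Val Sig Γ ρ) : Comp Sig Γ τ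
  | ret {Γ : List Ty} {τ : Ty} (V : Val Sig Γ τ) : Comp Sig Γ τ
  /-- `let M ⇒ x in N` -/
  | letin {Γ : List Ty} {ρ τ : Ty} (M : Comp Sig Γ ρ) (N : Comp Sig (ρ :: Γ) τ) : Comp Sig Γ τ
  | fix {Γ : List Ty} {τ ρ : Ty} (V : Val Sig Γ (Ty.arr (Ty.arr τ ρ) (Ty.arr τ ρ))) :
      Comp Sig Γ (Ty.arr τ ρ)
  /-- `case V in {Z ⇒ M, S(x) ⇒ N}` -/
  | natCase {Γ : List Ty} {τ : Ty} (V : Val Sig Γ Ty.nat) (M : Comp Sig Γ τ)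
      (N : Comp Sig (Ty.nat :: Γ) τ) : Comp Sig Γ τ
  /-- `σ(V; W)` -/
  | op {Γ : List Ty} {τ : Ty} (σ : Sig) (V : Val Sig Γ Ty.nat)
      (W : Val Sig Γ (Ty.arr Ty.nat τ)) : Comp Sig Γ τ

end

mutual

def Val.rename {Sig : Type u} {Γ : List Ty} {τ : Ty} :
    Val Sig Γ τ → {Δ : List Ty} → Ren Γ Δ → Val Sig Δ τ
  | Val.var x, _, r => Val.var (r _ x)
  | Val.star, _, _ => Val.star
  | Val.zero, _, _ => Val.zero
  | Val.succ V, _, r => Val.succ (V.rename r)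
  | Val.lam M, _, r => Val.lam (M.rename (r.lift _))

def Comp.rename {Sig : Type u} {Γ : List Ty} {τ : Ty} :
    Comp Sig Γ τ → {Δ : List Ty} → Ren Γ Δ → Comp Sig Δ τ
  | Comp.app V W, _, r => Comp.app (V.rename r) (W.rename r)
  | Comp.ret V, _, r => Comp.ret (V.rename r)
  | Comp.letin M N, _, r => Comp.letin (M.rename r) (N.rename (r.lift _))
  | Comp.fix V, _, r => Comp.fix (V.rename r)
  | Comp.natCase V M N, _, r => Comp.natCase (V.rename r) (M.rename r) (N.rename (r.lift _))
  | Comp.op σ V W, _, r => Comp.op σ (V.rename r) (W.rename r)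

end

/-- Simultaneous substitutions. -/
def Subst (Sig : Type u) (Γ Δ : List Ty) : Type u := ∀ A : Ty, TVar Γ A → Val Sig Δ A

def Subst.idn {Sig : Type u} {Γ : List Ty} : Subst Sig Γ Γ := fun _ x => Val.var x

/-- Extend a substitution by a value for the most recent variable. -/
def Subst.cons {Sig : Type u} {Γ Δ : List Ty} {B : Ty} (V : Val Sig Δ B) (s : Subst Sig Γ Δ) :
    Subst Sig (B :: Γ) Δ
  | _, TVar.here => V
  | _, TVar.there x => s _ x

/-- Push a substitution under a binder. -/
def Subst.lift {Sig : Type u} {Γ Δ : List Ty} (s : Subst Sig Γ Δ) (B : Ty) :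
    Subst Sig (B :: Γ) (B :: Δ) :=
  Subst.cons (Val.var TVar.here) (fun _ x => (s _ x).rename (Ren.wk [B]))

mutual

def Val.subst {Sig : Type u} {Γ : List Ty} {τ : Ty} :
    Val Sig Γ τ → {Δ : List Ty} → Subst Sig Γ Δ → Val Sig Δ τ
  | Val.var x, _, s => s _ x
  | Val.star, _, _ => Val.star
  | Val.zero, _, _ => Val.zero
  | Val.succ V, _, s => Val.succ (V.subst s)
  | Val.lam M, _, s => Val.lam (M.subst (s.lift _))

def Comp.subst {Sig : Type u} {Γ : List Ty} {τ : Ty} :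
    Comp Sig Γ τ → {Δ : List Ty} → Subst Sig Γ Δ → Comp Sig Δ τ
  | Comp.app V W, _, s => Comp.app (V.subst s) (W.subst s)
  | Comp.ret V, _, s => Comp.ret (V.subst s)
  | Comp.letin M N, _, s => Comp.letin (M.subst s) (N.subst (s.lift _))
  | Comp.fix V, _, s => Comp.fix (V.subst s)
  | Comp.natCase V M N, _, s => Comp.natCase (V.subst s) (M.subst s) (N.subst (s.lift _))
  | Comp.op σ V W, _, s => Comp.op σ (V.subst s) (W.subst s)

end

/-- `M[V/x]` for the most recent variable `x`. -/
def Comp.inst {Sig : Type u} {Γ : List Ty} {ρ τ : Ty} (M : Comp Sig (ρ :: Γ) τ)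
    (V : Val Sig Γ ρ) : Comp Sig Γ τ :=
  M.subst (Subst.cons V Subst.idn)

/-- The numeral `S^n(Z)`. -/
def num {Sig : Type u} {Γ : List Ty} : ℕ → Val Sig Γ Ty.nat
  | 0 => Val.zero
  | n + 1 => Val.succ (num n)

/-- The number denoted by a numeral (`num_toNat` below: every closed value of type `nat` is the
numeral of this number); the value on other values is irrelevant. -/
def Val.toNat {Sig : Type u} {Γ : List Ty} {τ : Ty} : Val Sig Γ τ → ℕ
  | Val.succ V => V.toNat + 1
  | _ => 0

theorem num_toNat {Sig : Type u} : ∀ V : Val Sig [] Ty.nat, num V.toNat = V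
  | Val.zero => rfl
  | Val.succ V => by rw [Val.toNat, num, num_toNat V]

/-- Evaluation stacks `Γ ⊢ S : τ ⇒ ρ`. -/
inductive Stack (Sig : Type u) (Γ : List Ty) : Ty → Ty → Type u
  | id {ρ : Ty} : Stack Sig Γ ρ ρ
  /-- `S ∘ (let (-) ⇒ x in M)` -/
  | push {τ τ₁ ρ : Ty} (S : Stack Sig Γ τ₁ ρ) (M : Comp Sig (τ :: Γ) τ₁) : Stack Sig Γ τ ρ

/-- `return λx:τ. let F (λy:τ. let fix F ⇒ z in z y) ⇒ w in w x`. -/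
def fixUnfold {Sig : Type u} {τ ρ : Ty} (F : Val Sig [] (Ty.arr (Ty.arr τ ρ) (Ty.arr τ ρ))) :
    Comp Sig [] (Ty.arr τ ρ) :=
  Comp.ret (Val.lam
    (Comp.letin
      (Comp.app (F.rename (Ren.wk [τ]))
        (Val.lam (Comp.letin (Comp.fix (F.rename (Ren.wk [τ, τ])))
          (Comp.app (Val.var TVar.here) (Val.var (TVar.there TVar.here))))))
      (Comp.app (Val.var TVar.here) (Val.var (TVar.there TVar.here)))))

/-- The reduction relation `⇝` on closed computations. -/
inductive Red {Sig : Type u} : {τ : Ty} → Comp Sig [] τ → Comp Sig [] τ → Prop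
  | beta {ρ τ : Ty} (M : Comp Sig [ρ] τ) (V : Val Sig [] ρ) :
      Red (Comp.app (Val.lam M) V) (M.inst V)
  | fix {τ ρ : Ty} (F : Val Sig [] (Ty.arr (Ty.arr τ ρ) (Ty.arr τ ρ))) :
      Red (Comp.fix F) (fixUnfold F)
  | caseZero {τ : Ty} (M : Comp Sig [] τ) (N : Comp Sig [Ty.nat] τ) :
      Red (Comp.natCase Val.zero M N) M
  | caseSucc {τ : Ty} (V : Val Sig [] Ty.nat) (M : Comp Sig [] τ) (N : Comp Sig [Ty.nat] τ) :
      Red (Comp.natCase (Val.succ V) M N) (N.inst V)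

/-- Closed configurations `(S, M)` with `S : τ ⇒ ρ` and `M : τ`. -/
structure Config (Sig : Type u) (ρ : Ty) : Type u where
  {ty : Ty}
  stack : Stack Sig [] ty ρ
  comp : Comp Sig [] ty

/-- The reduction relation `↣` on configurations. -/
inductive Step {Sig : Type u} {ρ : Ty} : Config Sig ρ → Config Sig ρ → Prop
  | push {τ τ₁ : Ty} (S : Stack Sig [] τ₁ ρ) (N : Comp Sig [] τ) (M : Comp Sig [τ] τ₁) :
      Step ⟨S, Comp.letin N M⟩ ⟨Stack.push S M, N⟩
  | pop {τ τ₁ : Ty} (S : Stack Sig [] τ₁ ρ) (M : Comp Sig [τ] τ₁) (V : Val Sig [] τ) :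
      Step ⟨Stack.push S M, Comp.ret V⟩ ⟨S, M.inst V⟩
  | red {τ : Ty} (S : Stack Sig [] τ ρ) (M N : Comp Sig [] τ) (h : Red M N) :
      Step ⟨S, M⟩ ⟨S, N⟩

/-- The unique `⇝`-successor of a closed computation, if there is one. -/
def redNext {Sig : Type u} {τ : Ty} : Comp Sig [] τ → Option (Comp Sig [] τ)
  | Comp.app (Val.lam M) V => some (M.inst V)
  | Comp.fix F => some (fixUnfold F)
  | Comp.natCase Val.zero M _ => some M
  | Comp.natCase (Val.succ V) _ N => some (N.inst V)
  | Comp.ret _ => none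
  | Comp.letin _ _ => none
  | Comp.op _ _ _ => none

theorem redNext_eq_some_iff {Sig : Type u} {τ : Ty} (M N : Comp Sig [] τ) :
    redNext M = some N ↔ Red M N := by
  constructor
  · intro h
    match M, h with
    | Comp.app (Val.lam M) V, h => cases h; exact Red.beta M V
    | Comp.fix F, h => cases h; exact Red.fix F
    | Comp.natCase Val.zero M K, h => cases h; exact Red.caseZero _ K
    | Comp.natCase (Val.succ V) M K, h => cases h; exact Red.caseSucc V _ K
  · intro h
    cases h <;> rfl

/-- The unique `↣`-successor of a configuration, if there is one. -/
def next {Sig : Type u} {ρ : Ty} : Config Sig ρ → Option (Config Sig ρ)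
  | ⟨S, Comp.letin N M⟩ => some ⟨Stack.push S M, N⟩
  | ⟨Stack.push S M, Comp.ret V⟩ => some ⟨S, M.inst V⟩
  | ⟨S, M⟩ => (redNext M).map (fun N => ⟨S, N⟩)

theorem next_eq_some_iff {Sig : Type u} {ρ : Ty} (c d : Config Sig ρ) :
    next c = some d ↔ Step c d := by
  constructor
  · intro h
    obtain ⟨S, M⟩ := c
    have key : (redNext M).map (fun N => (⟨S, N⟩ : Config Sig ρ)) = some d →
        Step ⟨S, M⟩ d := by
      intro h
      obtain ⟨N, hN, rfl⟩ := Option.map_eq_some_iff.1 h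
      exact Step.red S M N ((redNext_eq_some_iff M N).1 hN)
    cases M with
    | letin N M => cases h; exact Step.push S N M
    | ret V =>
      cases S with
      | id => exact key h
      | push S M => cases h; exact Step.pop S M V
    | app V W => exact key h
    | fix F => exact key h
    | natCase V M N => exact key h
    | op σ V W => exact key h
  · intro h
    cases h with
    | push S N M => rfl
    | pop S M V => rfl
    | red S M N h => cases h <;> rfl

/-- The approximations `|S, M|_n`. -/
def approx {Sig : Type u} {ρ : Ty} : ℕ → Config Sig ρ → EffTree Sig (Val Sig [] ρ)
  | 0, _ => ⊥
  | n + 1, c =>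
    match next c with
    | some d => approx n d
    | none =>
      match c with
      | ⟨Stack.id, Comp.ret V⟩ => EffTree.leaf V
      | ⟨S, Comp.op σ V W⟩ =>
          EffTree.node σ V.toNat (fun k => approx n ⟨S, Comp.app W (num k)⟩)
      | _ => ⊥

theorem approx_le_succ {Sig : Type u} {ρ : Ty} (n : ℕ) :
    ∀ c : Config Sig ρ, approx n c ≤ approx (n + 1) c := by
  induction n with
  | zero => intro c; exact bot_le
  | succ n ih =>
    intro c
    have key : ∀ n, approx (n + 1) c =
        (match next c with
        | some d => approx n d
        | none =>
          match c with
          | ⟨Stack.id, Comp.ret V⟩ => EffTree.leaf V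
          | ⟨S, Comp.op σ V W⟩ =>
              EffTree.node σ V.toNat (fun k => approx n ⟨S, Comp.app W (num k)⟩)
          | _ => ⊥) := fun _ => rfl
    rw [key, key]
    split
    · exact ih _
    · split
      · exact le_rfl
      · exact EffTree.node_mono _ _ (fun k => ih _)
      · exact le_rfl

/-- The computation tree `|S, M|`, the least upper bound of the `|S, M|_n`. -/
noncomputable def tree {Sig : Type u} {ρ : Ty} (c : Config Sig ρ) :
    EffTree Sig (Val Sig [] ρ) :=
  OmegaCompletePartialOrder.ωSup
    ⟨fun n => approx n c, monotone_nat_of_le_succ (fun n => approx_le_succ n c)⟩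

end EPCF

/-! ## ECPS -/

namespace ECPS

inductive Ty : Type
  | neg (As : List Ty) : Ty
  | nat : Ty
  | unit : Ty

mutual

/-- Values `Γ ⊢ v : A`. In `λ(x₁,…,xₙ):(A₁,…,Aₙ). t` the environment of the body is
`A₁ :: … :: Aₙ :: Γ`. -/
inductive Val (Sig : Type u) : List Ty → Ty → Type u
  | var {Γ : List Ty} {A : Ty} (x : TVar Γ A) : Val Sig Γ A
  | zero {Γ : List Ty} : Val Sig Γ Ty.nat
  | succ {Γ : List Ty} (v : Val Sig Γ Ty.nat) : Val Sig Γ Ty.nat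
  | star {Γ : List Ty} : Val Sig Γ Ty.unit
  | lam {Γ : List Ty} (As : List Ty) (t : Comp Sig (As ++ Γ)) : Val Sig Γ (Ty.neg As)

/-- Computations `Γ ⊢ t`. -/
inductive Comp (Sig : Type u) : List Ty → Type u
  | app {Γ As : List Ty} (v : Val Sig Γ (Ty.neg As)) (ws : Args Sig Γ As) : Comp Sig Γ
  /-- `(μx.v)(w₁,…,wₙ)` -/
  | mu {Γ As : List Ty} (v : Val Sig (Ty.neg As :: Γ) (Ty.neg As)) (ws : Args Sig Γ As) :
      Comp Sig Γ
  /-- `σ(v, x.t)` -/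
  | op {Γ : List Ty} (σ : Sig) (v : Val Sig Γ Ty.nat) (t : Comp Sig (Ty.nat :: Γ)) : Comp Sig Γ
  /-- the termination effect `↓` -/
  | down {Γ : List Ty} : Comp Sig Γ
  /-- `case v in {zero ⇒ t, succ(x) ⇒ s}` -/
  | natCase {Γ : List Ty} (v : Val Sig Γ Ty.nat) (t : Comp Sig Γ)
      (s : Comp Sig (Ty.nat :: Γ)) : Comp Sig Γ

/-- Argument tuples `(w₁,…,wₙ)` of types `(A₁,…,Aₙ)`. -/
inductive Args (Sig : Type u) : List Ty → List Ty → Type u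
  | nil {Γ : List Ty} : Args Sig Γ []
  | cons {Γ As : List Ty} {A : Ty} (w : Val Sig Γ A) (ws : Args Sig Γ As) :
      Args Sig Γ (A :: As)

end

mutual

def Val.rename {Sig : Type u} {Γ : List Ty} {A : Ty} :
    Val Sig Γ A → {Δ : List Ty} → Ren Γ Δ → Val Sig Δ A
  | Val.var x, _, r => Val.var (r _ x)
  | Val.zero, _, _ => Val.zero
  | Val.succ v, _, r => Val.succ (v.rename r)
  | Val.star, _, _ => Val.star
  | Val.lam As t, _, r => Val.lam As (t.rename (r.lifts As))

def Comp.rename {Sig : Type u} {Γ : List Ty} :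
    Comp Sig Γ → {Δ : List Ty} → Ren Γ Δ → Comp Sig Δ
  | Comp.app v ws, _, r => Comp.app (v.rename r) (ws.rename r)
  | Comp.mu v ws, _, r => Comp.mu (v.rename (r.lift _)) (ws.rename r)
  | Comp.op σ v t, _, r => Comp.op σ (v.rename r) (t.rename (r.lift _))
  | Comp.down, _, _ => Comp.down
  | Comp.natCase v t s, _, r => Comp.natCase (v.rename r) (t.rename r) (s.rename (r.lift _))

def Args.rename {Sig : Type u} {Γ As : List Ty} :
    Args Sig Γ As → {Δ : List Ty} → Ren Γ Δ → Args Sig Δ As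
  | Args.nil, _, _ => Args.nil
  | Args.cons w ws, _, r => Args.cons (w.rename r) (ws.rename r)

end

/-- Simultaneous substitutions. -/
def Subst (Sig : Type u) (Γ Δ : List Ty) : Type u := ∀ A : Ty, TVar Γ A → Val Sig Δ A

def Subst.idn {Sig : Type u} {Γ : List Ty} : Subst Sig Γ Γ := fun _ x => Val.var x

/-- Extend a substitution by a value for the most recent variable. -/
def Subst.cons {Sig : Type u} {Γ Δ : List Ty} {B : Ty} (v : Val Sig Δ B) (s : Subst Sig Γ Δ) :
    Subst Sig (B :: Γ) Δ
  | _, TVar.here => v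
  | _, TVar.there x => s _ x

/-- Push a substitution under one binder. -/
def Subst.lift {Sig : Type u} {Γ Δ : List Ty} (s : Subst Sig Γ Δ) (B : Ty) :
    Subst Sig (B :: Γ) (B :: Δ) :=
  Subst.cons (Val.var TVar.here) (fun _ x => (s _ x).rename (Ren.wk [B]))

/-- Push a substitution under several binders. -/
def Subst.lifts {Sig : Type u} {Γ Δ : List Ty} (s : Subst Sig Γ Δ) :
    (Bs : List Ty) → Subst Sig (Bs ++ Γ) (Bs ++ Δ)
  | [] => s
  | B :: Bs => (s.lifts Bs).lift B

/-- Extend a substitution by a tuple of values for the most recent variables. -/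
def Subst.append {Sig : Type u} {Γ Δ As : List Ty} :
    Args Sig Δ As → Subst Sig Γ Δ → Subst Sig (As ++ Γ) Δ
  | Args.nil, s => s
  | Args.cons w ws, s => Subst.cons w (Subst.append ws s)

mutual

def Val.subst {Sig : Type u} {Γ : List Ty} {A : Ty} :
    Val Sig Γ A → {Δ : List Ty} → Subst Sig Γ Δ → Val Sig Δ A
  | Val.var x, _, s => s _ x
  | Val.zero, _, _ => Val.zero
  | Val.succ v, _, s => Val.succ (v.subst s)
  | Val.star, _, _ => Val.star
  | Val.lam As t, _, s => Val.lam As (t.subst (s.lifts As))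

def Comp.subst {Sig : Type u} {Γ : List Ty} :
    Comp Sig Γ → {Δ : List Ty} → Subst Sig Γ Δ → Comp Sig Δ
  | Comp.app v ws, _, s => Comp.app (v.subst s) (ws.subst s)
  | Comp.mu v ws, _, s => Comp.mu (v.subst (s.lift _)) (ws.subst s)
  | Comp.op σ v t, _, s => Comp.op σ (v.subst s) (t.subst (s.lift _))
  | Comp.down, _, _ => Comp.down
  | Comp.natCase v t u, _, s => Comp.natCase (v.subst s) (t.subst s) (u.subst (s.lift _))

def Args.subst {Sig : Type u} {Γ As : List Ty} :
    Args Sig Γ As → {Δ : List Ty} → Subst Sig Γ Δ → Args Sig Δ As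
  | Args.nil, _, _ => Args.nil
  | Args.cons w ws, _, s => Args.cons (w.subst s) (ws.subst s)

end

/-- `t[w/x]` for the most recent variable `x`. -/
def Comp.inst {Sig : Type u} {Γ : List Ty} {A : Ty} (t : Comp Sig (A :: Γ)) (w : Val Sig Γ A) :
    Comp Sig Γ :=
  t.subst (Subst.cons w Subst.idn)

/-- `v[w/x]` for the most recent variable `x`. -/
def Val.inst {Sig : Type u} {Γ : List Ty} {A B : Ty} (v : Val Sig (A :: Γ) B)
    (w : Val Sig Γ A) : Val Sig Γ B :=
  v.subst (Subst.cons w Subst.idn)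

/-- `t[w₁/x₁,…,wₙ/xₙ]` for the most recent variables `x₁,…,xₙ`. -/
def Comp.instArgs {Sig : Type u} {Γ As : List Ty} (t : Comp Sig (As ++ Γ))
    (ws : Args Sig Γ As) : Comp Sig Γ :=
  t.subst (Subst.append ws Subst.idn)

/-- The tuple `(y₁,…,yₙ)` of the most recent variables. -/
def Args.vars {Sig : Type u} {Γ : List Ty} : (As : List Ty) → Args Sig (As ++ Γ) As
  | [] => Args.nil
  | A :: As => Args.cons (Val.var TVar.here) ((Args.vars As).rename (Ren.wk [A]))

/-- The numeral `succ^n(zero)`. -/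
def num {Sig : Type u} {Γ : List Ty} : ℕ → Val Sig Γ Ty.nat
  | 0 => Val.zero
  | n + 1 => Val.succ (num n)

/-- The number denoted by a numeral (`num_toNat` below: every closed value of type `nat` is the
numeral of this number); the value on other values is irrelevant. -/
def Val.toNat {Sig : Type u} {Γ : List Ty} {A : Ty} : Val Sig Γ A → ℕ
  | Val.succ v => v.toNat + 1
  | _ => 0

theorem num_toNat {Sig : Type u} : ∀ v : Val Sig [] Ty.nat, num v.toNat = v
  | Val.zero => rfl
  | Val.succ v => by rw [Val.toNat, num, num_toNat v]

/-- The value `λ(y₁,…,yₙ):(A₁,…,Aₙ). (μx.v)(y₁,…,yₙ)`. -/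
def muVal {Sig : Type u} {Γ As : List Ty} (v : Val Sig (Ty.neg As :: Γ) (Ty.neg As)) :
    Val Sig Γ (Ty.neg As) :=
  Val.lam As (Comp.mu (v.rename ((Ren.wk As).lift _)) (Args.vars As))

/-- The reduction relation `⟶` on closed computations. -/
inductive Step {Sig : Type u} : Comp Sig [] → Comp Sig [] → Prop
  | beta {As : List Ty} (t : Comp Sig (As ++ [])) (ws : Args Sig [] As) :
      Step (Comp.app (Val.lam As t) ws) (t.instArgs ws)
  | mu {As : List Ty} (v : Val Sig [Ty.neg As] (Ty.neg As)) (ws : Args Sig [] As) :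
      Step (Comp.mu v ws) (Comp.app (v.inst (muVal v)) ws)
  | caseZero (s : Comp Sig []) (t : Comp Sig [Ty.nat]) : Step (Comp.natCase Val.zero s t) s
  | caseSucc (v : Val Sig [] Ty.nat) (s : Comp Sig []) (t : Comp Sig [Ty.nat]) :
      Step (Comp.natCase (Val.succ v) s t) (t.inst v)

/-- The unique `⟶`-successor of a closed computation, if there is one. -/
def next {Sig : Type u} : Comp Sig [] → Option (Comp Sig [])
  | Comp.app (Val.lam _ t) ws => some (t.instArgs ws)
  | Comp.mu v ws => some (Comp.app (v.inst (muVal v)) ws)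
  | Comp.natCase Val.zero s _ => some s
  | Comp.natCase (Val.succ v) _ t => some (t.inst v)
  | Comp.op _ _ _ => none
  | Comp.down => none

theorem next_eq_some_iff {Sig : Type u} (s t : Comp Sig []) : next s = some t ↔ Step s t := by
  constructor
  · intro h
    match s, h with
    | Comp.app (Val.lam _ t) ws, h => cases h; exact Step.beta t ws
    | Comp.mu v ws, h => cases h; exact Step.mu v ws
    | Comp.natCase Val.zero s t, h => cases h; exact Step.caseZero _ t
    | Comp.natCase (Val.succ v) s t, h => cases h; exact Step.caseSucc v _ t
  · intro h
    cases h <;> rfl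

/-- The approximations `⟦t⟧_n`; the only non-`⊥` leaf is `↓`, represented by `()`. -/
def approx {Sig : Type u} : ℕ → Comp Sig [] → EffTree Sig PUnit.{u + 1}
  | 0, _ => ⊥
  | n + 1, t =>
    match next t with
    | some s => approx n s
    | none =>
      match t with
      | Comp.op σ v s => EffTree.node σ v.toNat (fun k => approx n (s.inst (num k)))
      | Comp.down => EffTree.leaf PUnit.unit
      | _ => ⊥

theorem approx_le_succ {Sig : Type u} (n : ℕ) :
    ∀ t : Comp Sig [], approx n t ≤ approx (n + 1) t := by
  induction n with
  | zero => intro t; exact bot_le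
  | succ n ih =>
    intro t
    have key : ∀ n, approx (n + 1) t =
        (match next t with
        | some s => approx n s
        | none =>
          match t with
          | Comp.op σ v s => EffTree.node σ v.toNat (fun k => approx n (s.inst (num k)))
          | Comp.down => EffTree.leaf PUnit.unit
          | _ => ⊥) := fun _ => rfl
    rw [key, key]
    split
    · exact ih _
    · split
      · exact EffTree.node_mono _ _ (fun k => ih _)
      · exact le_rfl
      · exact le_rfl

/-- The computation tree `⟦t⟧`, the least upper bound of the `⟦t⟧_n`. -/
noncomputable def tree {Sig : Type u} (t : Comp Sig []) : EffTree Sig PUnit.{u + 1} :=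
  OmegaCompletePartialOrder.ωSup
    ⟨fun n => approx n t, monotone_nat_of_le_succ (fun n => approx_le_succ n t)⟩

/-- A one-element argument tuple. -/
def Args.one {Sig : Type u} {Γ : List Ty} {A : Ty} (w : Val Sig Γ A) : Args Sig Γ [A] :=
  Args.cons w Args.nil

/-- A two-element argument tuple. -/
def Args.two {Sig : Type u} {Γ : List Ty} {A B : Ty} (w₁ : Val Sig Γ A) (w₂ : Val Sig Γ B) :
    Args Sig Γ [A, B] :=
  Args.cons w₁ (Args.cons w₂ Args.nil)

/-- The `i`-th most recent variable, `i = 0, 1, 2, 3`. -/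
def Val.v0 {Sig : Type u} {Γ : List Ty} {A : Ty} : Val Sig (A :: Γ) A :=
  Val.var TVar.here

def Val.v1 {Sig : Type u} {Γ : List Ty} {A B : Ty} : Val Sig (B :: A :: Γ) A :=
  Val.var (TVar.there TVar.here)

def Val.v2 {Sig : Type u} {Γ : List Ty} {A B C : Ty} : Val Sig (C :: B :: A :: Γ) A :=
  Val.var (TVar.there (TVar.there TVar.here))

def Val.v3 {Sig : Type u} {Γ : List Ty} {A B C D : Ty} : Val Sig (D :: C :: B :: A :: Γ) A :=
  Val.var (TVar.there (TVar.there (TVar.there TVar.here)))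

end ECPS

/-! ## The CPS translation -/

namespace EPCF

/-- `τ*` -/
def Ty.cps : Ty → ECPS.Ty
  | Ty.unit => ECPS.Ty.unit
  | Ty.nat => ECPS.Ty.nat
  | Ty.arr ρ τ => ECPS.Ty.neg [ρ.cps, ECPS.Ty.neg [τ.cps]]

/-- `Γ*` -/
def ctxCps : List Ty → List ECPS.Ty
  | [] => []
  | τ :: Γ => τ.cps :: ctxCps Γ

def varCps {Γ : List Ty} {τ : Ty} : TVar Γ τ → TVar (ctxCps Γ) τ.cps
  | TVar.here => TVar.here
  | TVar.there x => TVar.there (varCps x)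

open ECPS.Val (v0 v1 v2 v3) in
open ECPS.Args (one two) in
/-- The translation of `fix F`, where `f = F*`, `A = τ*`, `B = ρ*`:
```
λk:¬¬(A,¬B).
  (μx. λc:¬¬(A,¬B).
     c (λ(x₁,k₁):(A,¬B).
          (λk₂:¬B.
             (λl:¬¬(A,¬B).
                f (λ(y,l₁):(A,¬B). (λp:¬B. x (λz:¬(A,¬B). (λp₁:¬B. z (y,p₁)) p)) l₁, l))
             (λw:¬(A,¬B). (λl₂:¬B. w (x₁,l₂)) k₂))
          k₁))
  k
``` -/
def fixCps {Sig : Type u} {Γ : List ECPS.Ty} (A B : ECPS.Ty)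
    (f : ECPS.Val Sig Γ
      (ECPS.Ty.neg [ECPS.Ty.neg [A, ECPS.Ty.neg [B]],
        ECPS.Ty.neg [ECPS.Ty.neg [A, ECPS.Ty.neg [B]]]])) :
    ECPS.Val Sig Γ (ECPS.Ty.neg [ECPS.Ty.neg [ECPS.Ty.neg [A, ECPS.Ty.neg [B]]]]) :=
  let nB := ECPS.Ty.neg [B]
  let C := ECPS.Ty.neg [A, nB]
  let nC := ECPS.Ty.neg [C]
  -- environment of `bodyE`: y, l₁, l, k₂, x₁, k₁, c, x, k, Γ
  let bodyE : ECPS.Comp Sig (A :: nB :: nC :: nB :: A :: nB :: nC :: ECPS.Ty.neg [nC] :: nC :: Γ) :=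
    .app
      (.lam [nB]
        (.app (.var (.there (.there (.there (.there (.there (.there (.there (.there .here)))))))))
          (one (.lam [C] (.app (.lam [nB] (.app v1 (two v3 v0))) (one v1))))))
      (one v1)
  -- environment of `body`: x₁, k₁, c, x, k, Γ
  let body : ECPS.Comp Sig (A :: nB :: nC :: ECPS.Ty.neg [nC] :: nC :: Γ) :=
    .app
      (.lam [nB]
        (.app
          (.lam [nC]
            (.app (f.rename (Ren.wk [nC, nB, A, nB, nC, ECPS.Ty.neg [nC], nC]))
              (two (.lam [A, nB] bodyE) v0)))
          (one (.lam [C] (.app (.lam [nB] (.app v1 (two v3 v0))) (one v1))))))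
      (one v1)
  .lam [nC] (.mu (.lam [nC] (.app v0 (one (.lam [A, nB] body)))) (one v0))

mutual

/-- `(Γ ⊢ V : τ)* = Γ* ⊢ V* : τ*` -/
def Val.cps {Sig : Type u} {Γ : List Ty} {τ : Ty} :
    Val Sig Γ τ → ECPS.Val Sig (ctxCps Γ) τ.cps
  | Val.var x => ECPS.Val.var (varCps x)
  | Val.star => ECPS.Val.star
  | Val.zero => ECPS.Val.zero
  | Val.succ V => ECPS.Val.succ V.cps
  -- `λ(x,k). M* k`
  | @Val.lam _ _ ρ τ M =>
      ECPS.Val.lam [ρ.cps, ECPS.Ty.neg [τ.cps]]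
        (ECPS.Comp.app (M.cps.rename ((Ren.wk [ECPS.Ty.neg [τ.cps]]).lift ρ.cps))
          (ECPS.Args.one ECPS.Val.v1))

/-- `(Γ ⊢ M : τ)* = Γ* ⊢ M* : ¬¬τ*` -/
def Comp.cps {Sig : Type u} {Γ : List Ty} {τ : Ty} :
    Comp Sig Γ τ → ECPS.Val Sig (ctxCps Γ) (ECPS.Ty.neg [ECPS.Ty.neg [τ.cps]])
  -- `λk. V* (W*, k)`
  | Comp.app V W =>
      ECPS.Val.lam [ECPS.Ty.neg [τ.cps]]
        (ECPS.Comp.app (V.cps.rename (Ren.wk [ECPS.Ty.neg [τ.cps]]))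
          (ECPS.Args.two (W.cps.rename (Ren.wk [ECPS.Ty.neg [τ.cps]])) ECPS.Val.v0))
  -- `λk. k V*`
  | Comp.ret V =>
      ECPS.Val.lam [ECPS.Ty.neg [τ.cps]]
        (ECPS.Comp.app ECPS.Val.v0
          (ECPS.Args.one (V.cps.rename (Ren.wk [ECPS.Ty.neg [τ.cps]]))))
  -- `λk. M* (λx. N* k)`
  | @Comp.letin _ _ ρ _ M N =>
      ECPS.Val.lam [ECPS.Ty.neg [τ.cps]]
        (ECPS.Comp.app (M.cps.rename (Ren.wk [ECPS.Ty.neg [τ.cps]]))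
          (ECPS.Args.one (ECPS.Val.lam [ρ.cps]
            (ECPS.Comp.app (N.cps.rename ((Ren.wk [ECPS.Ty.neg [τ.cps]]).lift ρ.cps))
              (ECPS.Args.one ECPS.Val.v1)))))
  | @Comp.fix _ _ τ ρ F => fixCps τ.cps ρ.cps F.cps
  -- `λk. case V* in {zero ⇒ M* k, succ(x) ⇒ N* k}`
  | Comp.natCase V M N =>
      ECPS.Val.lam [ECPS.Ty.neg [τ.cps]]
        (ECPS.Comp.natCase (V.cps.rename (Ren.wk [ECPS.Ty.neg [τ.cps]]))
          (ECPS.Comp.app (M.cps.rename (Ren.wk [ECPS.Ty.neg [τ.cps]]))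
            (ECPS.Args.one ECPS.Val.v0))
          (ECPS.Comp.app (N.cps.rename ((Ren.wk [ECPS.Ty.neg [τ.cps]]).lift ECPS.Ty.nat))
            (ECPS.Args.one ECPS.Val.v1)))
  -- `λk. σ(V*, x. W* (x, k))`
  | Comp.op σ V W =>
      ECPS.Val.lam [ECPS.Ty.neg [τ.cps]]
        (ECPS.Comp.op σ (V.cps.rename (Ren.wk [ECPS.Ty.neg [τ.cps]]))
          (ECPS.Comp.app (W.cps.rename (Ren.wk [ECPS.Ty.nat, ECPS.Ty.neg [τ.cps]]))
            (ECPS.Args.two ECPS.Val.v0 ECPS.Val.v1)))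

end

/-- `(Γ ⊢ S : τ ⇒ ρ)* = Γ* ⊢ S* : ¬τ*`: `id* = λx. ↓` and
`(S ∘ (let (-) ⇒ x in M))* = λx. M* S*`. -/
def Stack.cps {Sig : Type u} {Γ : List Ty} {τ ρ : Ty} :
    Stack Sig Γ τ ρ → ECPS.Val Sig (ctxCps Γ) (ECPS.Ty.neg [τ.cps])
  | Stack.id => ECPS.Val.lam [τ.cps] ECPS.Comp.down
  | Stack.push S M =>
      ECPS.Val.lam [τ.cps]
        (ECPS.Comp.app M.cps (ECPS.Args.one (S.cps.rename (Ren.wk [τ.cps]))))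

end EPCF

namespace Ren

theorem lift_comp {T : Type} {Γ Δ Θ : List T} (r : Ren Γ Δ) (r' : Ren Δ Θ) (B : T) :
    (fun A x => r'.lift B A (r.lift B A x)) = Ren.lift (fun A x => r' A (r A x)) B := by
  funext A x
  cases x <;> rfl

theorem lifts_comp {T : Type} {Γ Δ Θ : List T} (r : Ren Γ Δ) (r' : Ren Δ Θ) (Bs : List T) :
    (fun A x => r'.lifts Bs A (r.lifts Bs A x)) = Ren.lifts (fun A x => r' A (r A x)) Bs := by
  induction Bs with
  | nil => rfl
  | cons B Bs ih => exact (lift_comp _ _ B).trans (congrArg (fun q => Ren.lift q B) ih)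

end Ren

namespace ECPS

mutual

theorem Val.rename_rename {Sig : Type u} {Γ : List Ty} {A : Ty} :
    ∀ (v : Val Sig Γ A) {Δ Θ : List Ty} (r : Ren Γ Δ) (r' : Ren Δ Θ),
      (v.rename r).rename r' = v.rename (fun A x => r' A (r A x))
  | Val.var x, _, _, r, r' => by simp only [Val.rename]
  | Val.zero, _, _, r, r' => by simp only [Val.rename]
  | Val.succ v, _, _, r, r' => by simp only [Val.rename, v.rename_rename]
  | Val.star, _, _, r, r' => by simp only [Val.rename]
  | Val.lam As t, _, _, r, r' => by
      simp only [Val.rename, t.rename_rename, Ren.lifts_comp]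

theorem Comp.rename_rename {Sig : Type u} {Γ : List Ty} :
    ∀ (t : Comp Sig Γ) {Δ Θ : List Ty} (r : Ren Γ Δ) (r' : Ren Δ Θ),
      (t.rename r).rename r' = t.rename (fun A x => r' A (r A x))
  | Comp.app v ws, _, _, r, r' => by
      simp only [Comp.rename, v.rename_rename, ws.rename_rename]
  | Comp.mu v ws, _, _, r, r' => by
      simp only [Comp.rename, v.rename_rename, ws.rename_rename, Ren.lift_comp]
  | Comp.op σ v t, _, _, r, r' => by
      simp only [Comp.rename, v.rename_rename, t.rename_rename, Ren.lift_comp]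
  | Comp.down, _, _, r, r' => by simp only [Comp.rename]
  | Comp.natCase v t s, _, _, r, r' => by
      simp only [Comp.rename, v.rename_rename, t.rename_rename, s.rename_rename, Ren.lift_comp]

theorem Args.rename_rename {Sig : Type u} {Γ As : List Ty} :
    ∀ (ws : Args Sig Γ As) {Δ Θ : List Ty} (r : Ren Γ Δ) (r' : Ren Δ Θ),
      (ws.rename r).rename r' = ws.rename (fun A x => r' A (r A x))
  | Args.nil, _, _, r, r' => by simp only [Args.rename]
  | Args.cons w ws, _, _, r, r' => by
      simp only [Args.rename, w.rename_rename, ws.rename_rename]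

end

namespace Subst

theorem lift_comp_ren {Sig : Type u} {Γ Δ Θ : List Ty} (r : Ren Γ Δ) (s : Subst Sig Δ Θ) (B : Ty) :
    (fun A x => s.lift B A (r.lift B A x)) = Subst.lift (fun A x => s A (r A x)) B := by
  funext A x
  cases x <;> rfl

theorem lifts_comp_ren {Sig : Type u} {Γ Δ Θ : List Ty} (r : Ren Γ Δ) (s : Subst Sig Δ Θ)
    (Bs : List Ty) :
    (fun A x => s.lifts Bs A (r.lifts Bs A x)) = Subst.lifts (fun A x => s A (r A x)) Bs := by
  induction Bs with
  | nil => rfl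
  | cons B Bs ih => exact (lift_comp_ren _ _ B).trans (congrArg (fun q => Subst.lift q B) ih)

theorem ren_comp_lift {Sig : Type u} {Γ Δ Θ : List Ty} (s : Subst Sig Γ Δ) (r : Ren Δ Θ) (B : Ty) :
    (fun A x => (s.lift B A x).rename (r.lift B)) =
      Subst.lift (fun A x => (s A x).rename r) B := by
  funext A x
  cases x with
  | here => rfl
  | there x =>
    change ((s A x).rename _).rename _ = ((s A x).rename _).rename _
    rw [Val.rename_rename, Val.rename_rename]
    rfl

theorem ren_comp_lifts {Sig : Type u} {Γ Δ Θ : List Ty} (s : Subst Sig Γ Δ) (r : Ren Δ Θ)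
    (Bs : List Ty) :
    (fun A x => (s.lifts Bs A x).rename (r.lifts Bs)) =
      Subst.lifts (fun A x => (s A x).rename r) Bs := by
  induction Bs with
  | nil => rfl
  | cons B Bs ih => exact (ren_comp_lift _ _ B).trans (congrArg (fun q => Subst.lift q B) ih)

theorem lift_idn {Sig : Type u} {Γ : List Ty} (B : Ty) :
    (Subst.idn : Subst Sig Γ Γ).lift B = Subst.idn := by
  funext A x
  cases x <;> rfl

theorem lifts_idn {Sig : Type u} {Γ : List Ty} (Bs : List Ty) :
    (Subst.idn : Subst Sig Γ Γ).lifts Bs = Subst.idn := by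
  induction Bs with
  | nil => rfl
  | cons B Bs ih => exact (congrArg (fun q => Subst.lift q B) ih).trans (lift_idn B)

end Subst

mutual

theorem Val.subst_rename {Sig : Type u} {Γ : List Ty} {A : Ty} :
    ∀ (v : Val Sig Γ A) {Δ Θ : List Ty} (r : Ren Γ Δ) (s : Subst Sig Δ Θ),
      (v.rename r).subst s = v.subst (fun A x => s A (r A x))
  | Val.var x, _, _, r, s => by simp only [Val.rename, Val.subst]
  | Val.zero, _, _, r, s => by simp only [Val.rename, Val.subst]
  | Val.succ v, _, _, r, s => by simp only [Val.rename, Val.subst, v.subst_rename]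
  | Val.star, _, _, r, s => by simp only [Val.rename, Val.subst]
  | Val.lam As t, _, _, r, s => by
      simp only [Val.rename, Val.subst, t.subst_rename, Subst.lifts_comp_ren]

theorem Comp.subst_rename {Sig : Type u} {Γ : List Ty} :
    ∀ (t : Comp Sig Γ) {Δ Θ : List Ty} (r : Ren Γ Δ) (s : Subst Sig Δ Θ),
      (t.rename r).subst s = t.subst (fun A x => s A (r A x))
  | Comp.app v ws, _, _, r, s => by
      simp only [Comp.rename, Comp.subst, v.subst_rename, ws.subst_rename]
  | Comp.mu v ws, _, _, r, s => by
      simp only [Comp.rename, Comp.subst, v.subst_rename, ws.subst_rename, Subst.lift_comp_ren]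
  | Comp.op σ v t, _, _, r, s => by
      simp only [Comp.rename, Comp.subst, v.subst_rename, t.subst_rename, Subst.lift_comp_ren]
  | Comp.down, _, _, r, s => by simp only [Comp.rename, Comp.subst]
  | Comp.natCase v t u, _, _, r, s => by
      simp only [Comp.rename, Comp.subst, v.subst_rename, t.subst_rename, u.subst_rename,
        Subst.lift_comp_ren]

theorem Args.subst_rename {Sig : Type u} {Γ As : List Ty} :
    ∀ (ws : Args Sig Γ As) {Δ Θ : List Ty} (r : Ren Γ Δ) (s : Subst Sig Δ Θ),
      (ws.rename r).subst s = ws.subst (fun A x => s A (r A x))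
  | Args.nil, _, _, r, s => by simp only [Args.rename, Args.subst]
  | Args.cons w ws, _, _, r, s => by
      simp only [Args.rename, Args.subst, w.subst_rename, ws.subst_rename]

end

mutual

theorem Val.rename_subst {Sig : Type u} {Γ : List Ty} {A : Ty} :
    ∀ (v : Val Sig Γ A) {Δ Θ : List Ty} (s : Subst Sig Γ Δ) (r : Ren Δ Θ),
      (v.subst s).rename r = v.subst (fun A x => (s A x).rename r)
  | Val.var x, _, _, s, r => by simp only [Val.subst]
  | Val.zero, _, _, s, r => by simp only [Val.rename, Val.subst]
  | Val.succ v, _, _, s, r => by simp only [Val.rename, Val.subst, v.rename_subst]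
  | Val.star, _, _, s, r => by simp only [Val.rename, Val.subst]
  | Val.lam As t, _, _, s, r => by
      simp only [Val.rename, Val.subst, t.rename_subst, Subst.ren_comp_lifts]

theorem Comp.rename_subst {Sig : Type u} {Γ : List Ty} :
    ∀ (t : Comp Sig Γ) {Δ Θ : List Ty} (s : Subst Sig Γ Δ) (r : Ren Δ Θ),
      (t.subst s).rename r = t.subst (fun A x => (s A x).rename r)
  | Comp.app v ws, _, _, s, r => by
      simp only [Comp.rename, Comp.subst, v.rename_subst, ws.rename_subst]
  | Comp.mu v ws, _, _, s, r => by
      simp only [Comp.rename, Comp.subst, v.rename_subst, ws.rename_subst, Subst.ren_comp_lift]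
  | Comp.op σ v t, _, _, s, r => by
      simp only [Comp.rename, Comp.subst, v.rename_subst, t.rename_subst, Subst.ren_comp_lift]
  | Comp.down, _, _, s, r => by simp only [Comp.rename, Comp.subst]
  | Comp.natCase v t u, _, _, s, r => by
      simp only [Comp.rename, Comp.subst, v.rename_subst, t.rename_subst, u.rename_subst,
        Subst.ren_comp_lift]

theorem Args.rename_subst {Sig : Type u} {Γ As : List Ty} :
    ∀ (ws : Args Sig Γ As) {Δ Θ : List Ty} (s : Subst Sig Γ Δ) (r : Ren Δ Θ),
      (ws.subst s).rename r = ws.subst (fun A x => (s A x).rename r)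
  | Args.nil, _, _, s, r => by simp only [Args.rename, Args.subst]
  | Args.cons w ws, _, _, s, r => by
      simp only [Args.rename, Args.subst, w.rename_subst, ws.rename_subst]

end

mutual

theorem Val.subst_idn {Sig : Type u} {Γ : List Ty} {A : Ty} :
    ∀ v : Val Sig Γ A, v.subst Subst.idn = v
  | Val.var x => by simp only [Val.subst, Subst.idn]
  | Val.zero => by simp only [Val.subst]
  | Val.succ v => by simp only [Val.subst, v.subst_idn]
  | Val.star => by simp only [Val.subst]
  | Val.lam As t => by simp only [Val.subst, Subst.lifts_idn, t.subst_idn]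

theorem Comp.subst_idn {Sig : Type u} {Γ : List Ty} :
    ∀ t : Comp Sig Γ, t.subst Subst.idn = t
  | Comp.app v ws => by simp only [Comp.subst, v.subst_idn, ws.subst_idn]
  | Comp.mu v ws => by simp only [Comp.subst, Subst.lift_idn, v.subst_idn, ws.subst_idn]
  | Comp.op σ v t => by simp only [Comp.subst, Subst.lift_idn, v.subst_idn, t.subst_idn]
  | Comp.down => by simp only [Comp.subst]
  | Comp.natCase v t u => by
      simp only [Comp.subst, Subst.lift_idn, v.subst_idn, t.subst_idn, u.subst_idn]

theorem Args.subst_idn {Sig : Type u} {Γ As : List Ty} :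
    ∀ ws : Args Sig Γ As, ws.subst Subst.idn = ws
  | Args.nil => by simp only [Args.subst]
  | Args.cons w ws => by simp only [Args.subst, w.subst_idn, ws.subst_idn]

end

theorem Val.rename_wk_lifts {Sig : Type u} {Γ Δ : List Ty} {A : Ty} (v : Val Sig Γ A)
    (r : Ren Γ Δ) (Bs : List Ty) :
    (v.rename (Ren.wk Bs)).rename (r.lifts Bs) = (v.rename r).rename (Ren.wk Bs) := by
  rw [Val.rename_rename, Val.rename_rename]
  congr 1
  funext C x
  induction Bs with
  | nil => rfl
  | cons B Bs ih => exact congrArg TVar.there ih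

theorem Val.rename_lift_wk_lift {Sig : Type u} {Γ Δ : List Ty} {A B C : Ty}
    (v : Val Sig (B :: Γ) A) (r : Ren Γ Δ) :
    (v.rename ((Ren.wk [C]).lift B)).rename ((r.lift C).lift B) =
      (v.rename (r.lift B)).rename ((Ren.wk [C]).lift B) := by
  rw [Val.rename_rename, Val.rename_rename]
  congr 1
  funext D x
  cases x <;> rfl

theorem Val.subst_wk_lifts {Sig : Type u} {Γ Δ : List Ty} {A : Ty} (v : Val Sig Γ A)
    (s : Subst Sig Γ Δ) (Bs : List Ty) :
    (v.rename (Ren.wk Bs)).subst (s.lifts Bs) = (v.subst s).rename (Ren.wk Bs) := by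
  rw [Val.subst_rename, Val.rename_subst]
  congr 1
  funext C x
  induction Bs with
  | nil =>
    have h := (Val.rename_subst (s C x) Subst.idn (Ren.wk []))
    rw [Val.subst_idn] at h
    exact (h.trans (Val.subst_idn (s C x))).symm
  | cons B Bs ih =>
    refine (congrArg (fun w => Val.rename w (Ren.wk [B])) ih).trans ?_
    rw [Val.rename_rename]
    rfl

theorem Val.subst_lift_wk_lift {Sig : Type u} {Γ Δ : List Ty} {A B C : Ty}
    (v : Val Sig (B :: Γ) A) (s : Subst Sig Γ Δ) :
    (v.rename ((Ren.wk [C]).lift B)).subst ((s.lift C).lift B) =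
      (v.subst (s.lift B)).rename ((Ren.wk [C]).lift B) := by
  rw [Val.subst_rename, Val.rename_subst]
  congr 1
  funext D x
  cases x with
  | here => rfl
  | there x =>
    change ((s D x).rename _).rename _ = ((s D x).rename _).rename _
    rw [Val.rename_rename, Val.rename_rename]
    rfl

/-- Substituting for weakened variables does nothing. -/
theorem Val.subst_append_wk {Sig : Type u} {Γ As : List Ty} {A : Ty} (v : Val Sig Γ A)
    (ws : Args Sig Γ As) :
    (v.rename (Ren.wk As)).subst (Subst.append ws Subst.idn) = v := by
  rw [Val.subst_rename]
  refine Eq.trans ?_ v.subst_idn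
  congr 1
  funext C x
  induction As with
  | nil => cases ws; rfl
  | cons B Bs ih => cases ws with | cons w ws => exact ih ws

end ECPS

namespace EPCF

open ECPS.Val (v0 v1 v2 v3) in
open ECPS.Args (one two) in
/-- The argument that the translation of `fix F` passes to its continuation, as a function of the
occurrence `g` of `F*` and the occurrence `m` of the recursion variable. -/
def fixArg {Sig : Type u} {Γ : List ECPS.Ty} (A B : ECPS.Ty)
    (g : ECPS.Val Sig
      ([ECPS.Ty.neg [ECPS.Ty.neg [A, ECPS.Ty.neg [B]]], ECPS.Ty.neg [B], A, ECPS.Ty.neg [B]] ++ Γ)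
      (ECPS.Ty.neg [ECPS.Ty.neg [A, ECPS.Ty.neg [B]],
        ECPS.Ty.neg [ECPS.Ty.neg [A, ECPS.Ty.neg [B]]]]))
    (m : ECPS.Val Sig
      ([ECPS.Ty.neg [B], A, ECPS.Ty.neg [B], ECPS.Ty.neg [ECPS.Ty.neg [A, ECPS.Ty.neg [B]]],
        ECPS.Ty.neg [B], A, ECPS.Ty.neg [B]] ++ Γ)
      (ECPS.Ty.neg [ECPS.Ty.neg [ECPS.Ty.neg [A, ECPS.Ty.neg [B]]]])) :
    ECPS.Val Sig Γ (ECPS.Ty.neg [A, ECPS.Ty.neg [B]]) :=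
  let nB := ECPS.Ty.neg [B]
  let C := ECPS.Ty.neg [A, nB]
  let nC := ECPS.Ty.neg [C]
  let bodyE : ECPS.Comp Sig (A :: nB :: nC :: nB :: A :: nB :: Γ) :=
    .app
      (.lam [nB]
        (.app m (one (.lam [C] (.app (.lam [nB] (.app v1 (two v3 v0))) (one v1))))))
      (one v1)
  let body : ECPS.Comp Sig (A :: nB :: Γ) :=
    .app
      (.lam [nB]
        (.app
          (.lam [nC] (.app g (two (.lam [A, nB] bodyE) v0)))
          (one (.lam [C] (.app (.lam [nB] (.app v1 (two v3 v0))) (one v1))))))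
      (one v1)
  .lam [A, nB] body

/-- The value under the `μ` in the translation of `fix F`, as a function of the occurrence
of `F*`. -/
def fixMuBody {Sig : Type u} {Γ : List ECPS.Ty} (A B : ECPS.Ty)
    (g : ECPS.Val Sig
      ([ECPS.Ty.neg [ECPS.Ty.neg [A, ECPS.Ty.neg [B]]], ECPS.Ty.neg [B], A, ECPS.Ty.neg [B],
        ECPS.Ty.neg [ECPS.Ty.neg [A, ECPS.Ty.neg [B]]],
        ECPS.Ty.neg [ECPS.Ty.neg [ECPS.Ty.neg [A, ECPS.Ty.neg [B]]]]] ++ Γ)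
      (ECPS.Ty.neg [ECPS.Ty.neg [A, ECPS.Ty.neg [B]],
        ECPS.Ty.neg [ECPS.Ty.neg [A, ECPS.Ty.neg [B]]]])) :
    ECPS.Val Sig (ECPS.Ty.neg [ECPS.Ty.neg [ECPS.Ty.neg [A, ECPS.Ty.neg [B]]]] :: Γ)
      (ECPS.Ty.neg [ECPS.Ty.neg [ECPS.Ty.neg [A, ECPS.Ty.neg [B]]]]) :=
  .lam [ECPS.Ty.neg [ECPS.Ty.neg [A, ECPS.Ty.neg [B]]]]
    (.app .v0 (.one (fixArg A B g
      (.var (.there (.there (.there (.there (.there (.there (.there (.there .here))))))))))))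

section
variable {Sig : Type u} {Γ Δ : List ECPS.Ty} (A B : ECPS.Ty)

theorem fixCps_eq
    (f : ECPS.Val Sig Γ
      (ECPS.Ty.neg [ECPS.Ty.neg [A, ECPS.Ty.neg [B]],
        ECPS.Ty.neg [ECPS.Ty.neg [A, ECPS.Ty.neg [B]]]])) :
    fixCps A B f = .lam [_] (.mu (fixMuBody A B (f.rename (Ren.wk [_, _, _, _, _, _, _])))
      (.one .v0)) := rfl

theorem fixCps_rename
    (f : ECPS.Val Sig Γ
      (ECPS.Ty.neg [ECPS.Ty.neg [A, ECPS.Ty.neg [B]],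
        ECPS.Ty.neg [ECPS.Ty.neg [A, ECPS.Ty.neg [B]]]])) (r : Ren Γ Δ) :
    (fixCps A B f).rename r = fixCps A B (f.rename r) := by
  rw [fixCps_eq, fixCps_eq, ← ECPS.Val.rename_wk_lifts]
  rfl

theorem fixCps_subst
    (f : ECPS.Val Sig Γ
      (ECPS.Ty.neg [ECPS.Ty.neg [A, ECPS.Ty.neg [B]],
        ECPS.Ty.neg [ECPS.Ty.neg [A, ECPS.Ty.neg [B]]]])) (s : ECPS.Subst Sig Γ Δ) :
    (fixCps A B f).subst s = fixCps A B (f.subst s) := by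
  rw [fixCps_eq, fixCps_eq, ← ECPS.Val.subst_wk_lifts]
  rfl

theorem fixCps_eq_muVal
    (f : ECPS.Val Sig Γ
      (ECPS.Ty.neg [ECPS.Ty.neg [A, ECPS.Ty.neg [B]],
        ECPS.Ty.neg [ECPS.Ty.neg [A, ECPS.Ty.neg [B]]]])) :
    fixCps A B f = ECPS.muVal (fixMuBody A B (f.rename (Ren.wk [_, _, _, _, _, _]))) := by
  have h : f.rename (Ren.wk [ECPS.Ty.neg [ECPS.Ty.neg [A, ECPS.Ty.neg [B]]], ECPS.Ty.neg [B], A,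
        ECPS.Ty.neg [B], ECPS.Ty.neg [ECPS.Ty.neg [A, ECPS.Ty.neg [B]]],
        ECPS.Ty.neg [ECPS.Ty.neg [ECPS.Ty.neg [A, ECPS.Ty.neg [B]]]],
        ECPS.Ty.neg [ECPS.Ty.neg [A, ECPS.Ty.neg [B]]]]) =
      (f.rename (Ren.wk [_, _, _, _, _, _])).rename ((Ren.wk [_]).lifts [_, _, _, _, _, _]) := by
    rw [ECPS.Val.rename_rename]
    rfl
  rw [fixCps_eq, h]
  rfl

end

theorem varCps_lift {Γ Δ : List Ty} (r : Ren Γ Δ) (r' : Ren (ctxCps Γ) (ctxCps Δ))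
    (h : ∀ (τ : Ty) (x : TVar Γ τ), r' _ (varCps x) = varCps (r τ x)) (B τ : Ty)
    (x : TVar (B :: Γ) τ) : r'.lift B.cps _ (varCps x) = varCps (r.lift B τ x) := by
  cases x with
  | here => rfl
  | there x => exact congrArg TVar.there (h τ x)

mutual

theorem Val.cps_rename {Sig : Type u} {Γ : List Ty} {τ : Ty} :
    ∀ (V : Val Sig Γ τ) {Δ : List Ty} (r : Ren Γ Δ) (r' : Ren (ctxCps Γ) (ctxCps Δ)),
      (∀ (τ : Ty) (x : TVar Γ τ), r' _ (varCps x) = varCps (r τ x)) →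
      (V.rename r).cps = V.cps.rename r'
  | Val.var x, _, r, r', h => by simp only [Val.rename, Val.cps, ECPS.Val.rename, h]
  | Val.star, _, _, _, _ => rfl
  | Val.zero, _, _, _, _ => rfl
  | Val.succ V, _, r, r', h => congrArg ECPS.Val.succ (V.cps_rename r r' h)
  | @Val.lam _ _ ρ τ M, _, r, r', h => by
      have hM := (congrArg
        (fun w => ECPS.Val.rename w ((Ren.wk [ECPS.Ty.neg [τ.cps]]).lift ρ.cps))
        (M.cps_rename (r.lift ρ) (r'.lift ρ.cps) (varCps_lift r r' h ρ))).trans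
          (ECPS.Val.rename_lift_wk_lift M.cps r').symm
      exact congrArg (fun w => ECPS.Val.lam [ρ.cps, ECPS.Ty.neg [τ.cps]]
        (ECPS.Comp.app w (ECPS.Args.one ECPS.Val.v1))) hM

theorem Comp.cps_rename {Sig : Type u} {Γ : List Ty} {τ : Ty} :
    ∀ (M : Comp Sig Γ τ) {Δ : List Ty} (r : Ren Γ Δ) (r' : Ren (ctxCps Γ) (ctxCps Δ)),
      (∀ (τ : Ty) (x : TVar Γ τ), r' _ (varCps x) = varCps (r τ x)) →
      (M.rename r).cps = M.cps.rename r'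
  | Comp.app V W, _, r, r', h => by
      simp only [Comp.rename, Comp.cps, V.cps_rename r r' h, W.cps_rename r r' h]
      rw [← ECPS.Val.rename_wk_lifts, ← ECPS.Val.rename_wk_lifts]
      rfl
  | Comp.ret V, _, r, r', h => by
      simp only [Comp.rename, Comp.cps, V.cps_rename r r' h]
      rw [← ECPS.Val.rename_wk_lifts]
      rfl
  | @Comp.letin _ _ ρ _ M N, _, r, r', h => by
      have hM := (congrArg (fun w => ECPS.Val.rename w (Ren.wk [ECPS.Ty.neg [τ.cps]]))
        (M.cps_rename r r' h)).trans (ECPS.Val.rename_wk_lifts M.cps r' [ECPS.Ty.neg [τ.cps]]).symm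
      have hN := (congrArg
        (fun w => ECPS.Val.rename w ((Ren.wk [ECPS.Ty.neg [τ.cps]]).lift ρ.cps))
        (N.cps_rename (r.lift ρ) (r'.lift ρ.cps) (varCps_lift r r' h ρ))).trans
          (ECPS.Val.rename_lift_wk_lift N.cps r').symm
      exact congrArg₂ (fun w w' => ECPS.Val.lam [ECPS.Ty.neg [τ.cps]]
        (ECPS.Comp.app w (ECPS.Args.one (ECPS.Val.lam [ρ.cps]
          (ECPS.Comp.app w' (ECPS.Args.one ECPS.Val.v1)))))) hM hN
  | Comp.fix V, _, r, r', h => by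
      simp only [Comp.rename, Comp.cps, V.cps_rename r r' h]
      exact (fixCps_rename _ _ _ _).symm
  | Comp.natCase V M N, _, r, r', h => by
      have hV := (congrArg (fun w => ECPS.Val.rename w (Ren.wk [ECPS.Ty.neg [τ.cps]]))
        (V.cps_rename r r' h)).trans (ECPS.Val.rename_wk_lifts V.cps r' [ECPS.Ty.neg [τ.cps]]).symm
      have hM := (congrArg (fun w => ECPS.Val.rename w (Ren.wk [ECPS.Ty.neg [τ.cps]]))
        (M.cps_rename r r' h)).trans (ECPS.Val.rename_wk_lifts M.cps r' [ECPS.Ty.neg [τ.cps]]).symm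
      have hN := (congrArg
        (fun w => ECPS.Val.rename w ((Ren.wk [ECPS.Ty.neg [τ.cps]]).lift ECPS.Ty.nat))
        (N.cps_rename (r.lift Ty.nat) (r'.lift ECPS.Ty.nat) (varCps_lift r r' h Ty.nat))).trans
          (ECPS.Val.rename_lift_wk_lift N.cps r').symm
      refine (congrArg₂ (fun v w => ECPS.Val.lam [ECPS.Ty.neg [τ.cps]]
        (ECPS.Comp.natCase v (ECPS.Comp.app w (ECPS.Args.one ECPS.Val.v0)) _)) hV hM).trans ?_
      exact congrArg (fun w => ECPS.Val.lam [ECPS.Ty.neg [τ.cps]]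
        (ECPS.Comp.natCase _ _ (ECPS.Comp.app w (ECPS.Args.one ECPS.Val.v1)))) hN
  | Comp.op σ V W, _, r, r', h => by
      simp only [Comp.rename, Comp.cps, V.cps_rename r r' h, W.cps_rename r r' h]
      rw [← ECPS.Val.rename_wk_lifts, ← ECPS.Val.rename_wk_lifts]
      rfl

end

theorem lift_varCps {Sig : Type u} {Γ Δ : List Ty} (s : Subst Sig Γ Δ)
    (s' : ECPS.Subst Sig (ctxCps Γ) (ctxCps Δ))
    (h : ∀ (τ : Ty) (x : TVar Γ τ), s' _ (varCps x) = (s τ x).cps) (B τ : Ty)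
    (x : TVar (B :: Γ) τ) : s'.lift B.cps _ (varCps x) = (s.lift B τ x).cps := by
  cases x with
  | here => rfl
  | there x =>
    refine Eq.trans ?_ (Val.cps_rename (s τ x) (Ren.wk [B]) (Ren.wk [B.cps]) fun _ _ => rfl).symm
    exact congrArg (fun w => ECPS.Val.rename w (Ren.wk [B.cps])) (h τ x)

mutual

theorem Val.cps_subst {Sig : Type u} {Γ : List Ty} {τ : Ty} :
    ∀ (V : Val Sig Γ τ) {Δ : List Ty} (s : Subst Sig Γ Δ)
      (s' : ECPS.Subst Sig (ctxCps Γ) (ctxCps Δ)),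
      (∀ (τ : Ty) (x : TVar Γ τ), s' _ (varCps x) = (s τ x).cps) →
      (V.subst s).cps = V.cps.subst s'
  | Val.var x, _, s, s', h => by simp only [Val.subst, Val.cps, ECPS.Val.subst, h]
  | Val.star, _, _, _, _ => rfl
  | Val.zero, _, _, _, _ => rfl
  | Val.succ V, _, s, s', h => congrArg ECPS.Val.succ (V.cps_subst s s' h)
  | @Val.lam _ _ ρ τ M, _, s, s', h => by
      have hM := (congrArg
        (fun w => ECPS.Val.rename w ((Ren.wk [ECPS.Ty.neg [τ.cps]]).lift ρ.cps))
        (M.cps_subst (s.lift ρ) (s'.lift ρ.cps) (lift_varCps s s' h ρ))).trans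
          (ECPS.Val.subst_lift_wk_lift M.cps s').symm
      exact congrArg (fun w => ECPS.Val.lam [ρ.cps, ECPS.Ty.neg [τ.cps]]
        (ECPS.Comp.app w (ECPS.Args.one ECPS.Val.v1))) hM

theorem Comp.cps_subst {Sig : Type u} {Γ : List Ty} {τ : Ty} :
    ∀ (M : Comp Sig Γ τ) {Δ : List Ty} (s : Subst Sig Γ Δ)
      (s' : ECPS.Subst Sig (ctxCps Γ) (ctxCps Δ)),
      (∀ (τ : Ty) (x : TVar Γ τ), s' _ (varCps x) = (s τ x).cps) →
      (M.subst s).cps = M.cps.subst s'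
  | Comp.app V W, _, s, s', h => by
      simp only [Comp.subst, Comp.cps, V.cps_subst s s' h, W.cps_subst s s' h]
      rw [← ECPS.Val.subst_wk_lifts, ← ECPS.Val.subst_wk_lifts]
      rfl
  | Comp.ret V, _, s, s', h => by
      simp only [Comp.subst, Comp.cps, V.cps_subst s s' h]
      rw [← ECPS.Val.subst_wk_lifts]
      rfl
  | @Comp.letin _ _ ρ _ M N, _, s, s', h => by
      have hM := (congrArg (fun w => ECPS.Val.rename w (Ren.wk [ECPS.Ty.neg [τ.cps]]))
        (M.cps_subst s s' h)).trans (ECPS.Val.subst_wk_lifts M.cps s' [ECPS.Ty.neg [τ.cps]]).symm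
      have hN := (congrArg
        (fun w => ECPS.Val.rename w ((Ren.wk [ECPS.Ty.neg [τ.cps]]).lift ρ.cps))
        (N.cps_subst (s.lift ρ) (s'.lift ρ.cps) (lift_varCps s s' h ρ))).trans
          (ECPS.Val.subst_lift_wk_lift N.cps s').symm
      exact congrArg₂ (fun w w' => ECPS.Val.lam [ECPS.Ty.neg [τ.cps]]
        (ECPS.Comp.app w (ECPS.Args.one (ECPS.Val.lam [ρ.cps]
          (ECPS.Comp.app w' (ECPS.Args.one ECPS.Val.v1)))))) hM hN
  | Comp.fix V, _, s, s', h => by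
      simp only [Comp.subst, Comp.cps, V.cps_subst s s' h]
      exact (fixCps_subst _ _ _ _).symm
  | Comp.natCase V M N, _, s, s', h => by
      have hV := (congrArg (fun w => ECPS.Val.rename w (Ren.wk [ECPS.Ty.neg [τ.cps]]))
        (V.cps_subst s s' h)).trans (ECPS.Val.subst_wk_lifts V.cps s' [ECPS.Ty.neg [τ.cps]]).symm
      have hM := (congrArg (fun w => ECPS.Val.rename w (Ren.wk [ECPS.Ty.neg [τ.cps]]))
        (M.cps_subst s s' h)).trans (ECPS.Val.subst_wk_lifts M.cps s' [ECPS.Ty.neg [τ.cps]]).symm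
      have hN := (congrArg
        (fun w => ECPS.Val.rename w ((Ren.wk [ECPS.Ty.neg [τ.cps]]).lift ECPS.Ty.nat))
        (N.cps_subst (s.lift Ty.nat) (s'.lift ECPS.Ty.nat) (lift_varCps s s' h Ty.nat))).trans
          (ECPS.Val.subst_lift_wk_lift N.cps s').symm
      refine (congrArg₂ (fun v w => ECPS.Val.lam [ECPS.Ty.neg [τ.cps]]
        (ECPS.Comp.natCase v (ECPS.Comp.app w (ECPS.Args.one ECPS.Val.v0)) _)) hV hM).trans ?_
      exact congrArg (fun w => ECPS.Val.lam [ECPS.Ty.neg [τ.cps]]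
        (ECPS.Comp.natCase _ _ (ECPS.Comp.app w (ECPS.Args.one ECPS.Val.v1)))) hN
  | Comp.op σ V W, _, s, s', h => by
      simp only [Comp.subst, Comp.cps, V.cps_subst s s' h, W.cps_subst s s' h]
      rw [← ECPS.Val.subst_wk_lifts, ← ECPS.Val.subst_wk_lifts]
      rfl

end

theorem Comp.cps_inst {Sig : Type u} {Γ : List Ty} {ρ τ : Ty} (M : Comp Sig (ρ :: Γ) τ)
    (V : Val Sig Γ ρ) : (M.inst V).cps = M.cps.inst V.cps := by
  apply Comp.cps_subst
  intro τ x
  cases x <;> rfl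

theorem num_cps {Sig : Type u} {Γ : List Ty} (n : ℕ) :
    (num n : Val Sig Γ Ty.nat).cps = ECPS.num n := by
  induction n with
  | zero => rfl
  | succ n ih => exact congrArg ECPS.Val.succ ih

theorem toNat_cps {Sig : Type u} : ∀ V : Val Sig [] Ty.nat, V.cps.toNat = V.toNat
  | Val.zero => rfl
  | Val.succ V => congrArg (· + 1) (toNat_cps V)

end EPCF

instance Ren.instSubsingletonNil {T : Type} {Δ : List T} : Subsingleton (Ren ([] : List T) Δ) :=
  ⟨fun r r' => by funext A x; cases x⟩

namespace ECPS

instance Subst.instSubsingletonNil {Sig : Type u} {Δ : List Ty} :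
    Subsingleton (Subst Sig [] Δ) :=
  ⟨fun s s' => by funext A x; cases x⟩

theorem Val.rename_of_closed_renaming {Sig : Type u} {Δ Θ : List Ty} {A : Ty} {v : Val Sig [] A}
    {w : Val Sig Δ A} (r : Ren Δ Θ) (h : ∃ q, w = v.rename q) : ∃ q, w.rename r = v.rename q := by
  obtain ⟨q, rfl⟩ := h
  exact ⟨_, v.rename_rename q r⟩

theorem Val.eq_of_closed_renaming {Sig : Type u} {Δ : List Ty} {A : Ty} {v : Val Sig [] A}
    {w : Val Sig Δ A} (q : Ren [] Δ) (h : ∃ q, w = v.rename q) : w = v.rename q := by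
  obtain ⟨q', rfl⟩ := h
  exact congrArg v.rename (Subsingleton.elim _ _)

theorem Val.subst_rename_of_closed {Sig : Type u} {Δ Θ : List Ty} {A : Ty} (v : Val Sig [] A)
    (r : Ren [] Δ) (s : Subst Sig Δ Θ) (q : Ren [] Θ) : (v.rename r).subst s = v.rename q := by
  rw [← Val.subst_idn (v.rename q), Val.subst_rename, Val.subst_rename]
  exact congrArg v.subst (Subsingleton.elim _ _)

/-- Under one binder, substituting for a weakened variable does nothing. -/
theorem Val.subst_lift_append_wk {Sig : Type u} {Γ : List Ty} {A B C : Ty} (v : Val Sig (B :: Γ) A)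
    (k : Val Sig Γ C) :
    (v.rename ((Ren.wk [C]).lift B)).subst ((Subst.append (Args.one k) Subst.idn).lift B) = v := by
  rw [Val.subst_rename]
  refine Eq.trans ?_ v.subst_idn
  congr 1
  funext D x
  cases x <;> rfl

theorem Val.subst_append_two_wk {Sig : Type u} {Γ : List Ty} {A B C : Ty} (v : Val Sig (B :: Γ) A)
    (w : Val Sig Γ B) (k : Val Sig Γ C) :
    (v.rename ((Ren.wk [C]).lift B)).subst (Subst.append (Args.two w k) Subst.idn) = v.inst w := by
  rw [Val.subst_rename]
  refine congrArg v.subst ?_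
  funext D x
  cases x <;> rfl

theorem Step.trans_eq {Sig : Type u} {s t t' : Comp Sig []} (h : Step s t) (e : t = t') :
    Step s t' := e ▸ h

end ECPS

namespace EPCF

section steps
variable {Sig : Type u} {τ ρ : Ty}
open ECPS.Args (one two)

theorem cps_app_step (V : Val Sig [] (Ty.arr ρ τ)) (W : Val Sig [] ρ)
    (k : ECPS.Val Sig [] (ECPS.Ty.neg [τ.cps])) :
    ECPS.Step (.app (Comp.app V W).cps (one k)) (.app V.cps (two W.cps k)) :=
  (ECPS.Step.beta _ _).trans_eq <|
    congrArg₂ (fun v w => ECPS.Comp.app v (two w k))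
      (ECPS.Val.subst_append_wk V.cps (one k)) (ECPS.Val.subst_append_wk W.cps (one k))

theorem cps_lam_step (M : Comp Sig [ρ] τ) (W : ECPS.Val Sig [] ρ.cps)
    (k : ECPS.Val Sig [] (ECPS.Ty.neg [τ.cps])) :
    ECPS.Step (.app (Val.lam M).cps (two W k)) (.app (M.cps.inst W) (one k)) :=
  (ECPS.Step.beta _ _).trans_eq <|
    congrArg (fun v => ECPS.Comp.app v (one k)) (ECPS.Val.subst_append_two_wk M.cps W k)

theorem cps_ret_step (V : Val Sig [] τ) (k : ECPS.Val Sig [] (ECPS.Ty.neg [τ.cps])) :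
    ECPS.Step (.app (Comp.ret V).cps (one k)) (.app k (one V.cps)) :=
  (ECPS.Step.beta _ _).trans_eq <|
    congrArg (fun v => ECPS.Comp.app k (one v)) (ECPS.Val.subst_append_wk V.cps (one k))

theorem cps_letin_step (M : Comp Sig [] ρ) (N : Comp Sig [ρ] τ)
    (k : ECPS.Val Sig [] (ECPS.Ty.neg [τ.cps])) :
    ECPS.Step (.app (Comp.letin M N).cps (one k))
      (.app M.cps (one (.lam [ρ.cps] (.app N.cps (one (k.rename (Ren.wk [ρ.cps]))))))) :=
  (ECPS.Step.beta _ _).trans_eq <|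
    congrArg₂ (fun v w => ECPS.Comp.app v
        (one (.lam [ρ.cps] (.app w (one (k.rename (Ren.wk [ρ.cps])))))))
      (ECPS.Val.subst_append_wk M.cps (one k)) (ECPS.Val.subst_lift_append_wk N.cps k)

theorem cps_push_step (M : Comp Sig [ρ] τ) (W : ECPS.Val Sig [] ρ.cps)
    (k : ECPS.Val Sig [] (ECPS.Ty.neg [τ.cps])) :
    ECPS.Step (.app (.lam [ρ.cps] (.app M.cps (one (k.rename (Ren.wk [ρ.cps]))))) (one W))
      (.app (M.cps.inst W) (one k)) :=
  (ECPS.Step.beta _ _).trans_eq <|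
    congrArg (fun v => ECPS.Comp.app (M.cps.inst W) (one v)) (ECPS.Val.subst_append_wk k (one W))

theorem cps_natCase_step (V : Val Sig [] Ty.nat) (M : Comp Sig [] τ) (N : Comp Sig [Ty.nat] τ)
    (k : ECPS.Val Sig [] (ECPS.Ty.neg [τ.cps])) :
    ECPS.Step (.app (Comp.natCase V M N).cps (one k))
      (.natCase V.cps (.app M.cps (one k))
        (.app N.cps (one (k.rename (Ren.wk [ECPS.Ty.nat]))))) :=
  (ECPS.Step.beta _ _).trans_eq <|
    (congrArg₂ (fun v w => ECPS.Comp.natCase v (.app w (one k)) _)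
      (ECPS.Val.subst_append_wk V.cps (one k)) (ECPS.Val.subst_append_wk M.cps (one k))).trans
    (congrArg (fun w => ECPS.Comp.natCase V.cps (.app M.cps (one k))
        (.app w (one (k.rename (Ren.wk [ECPS.Ty.nat])))))
      (ECPS.Val.subst_lift_append_wk (B := ECPS.Ty.nat) N.cps k))

theorem cps_caseSucc_step (V : Val Sig [] Ty.nat) (s : ECPS.Comp Sig [])
    (N : Comp Sig [Ty.nat] τ) (k : ECPS.Val Sig [] (ECPS.Ty.neg [τ.cps])) :
    ECPS.Step (.natCase V.succ.cps s (.app N.cps (one (k.rename (Ren.wk [ECPS.Ty.nat])))))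
      (.app (N.cps.inst V.cps) (one k)) :=
  (ECPS.Step.caseSucc _ _ _).trans_eq <|
    congrArg (fun v => ECPS.Comp.app (ECPS.Val.inst N.cps V.cps) (one v))
      (ECPS.Val.subst_append_wk k (one (A := ECPS.Ty.nat) V.cps))

theorem cps_op_step (σ : Sig) (V : Val Sig [] Ty.nat) (W : Val Sig [] (Ty.arr Ty.nat τ))
    (k : ECPS.Val Sig [] (ECPS.Ty.neg [τ.cps])) :
    ECPS.Step (.app (Comp.op σ V W).cps (one k))
      (.op σ V.cps (.app (W.cps.rename (Ren.wk [ECPS.Ty.nat]))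
        (two .v0 (k.rename (Ren.wk [ECPS.Ty.nat]))))) :=
  (ECPS.Step.beta _ _).trans_eq <|
    congrArg₂ (fun v w => ECPS.Comp.op σ v (.app w (two .v0 (k.rename (Ren.wk [ECPS.Ty.nat])))))
      (ECPS.Val.subst_append_wk V.cps (one k))
      (ECPS.Val.subst_rename_of_closed W.cps _ _ _)

theorem cps_op_child (W : Val Sig [] (Ty.arr Ty.nat τ))
    (k : ECPS.Val Sig [] (ECPS.Ty.neg [τ.cps])) (n : ℕ) :
    ECPS.Comp.inst (.app (W.cps.rename (Ren.wk [ECPS.Ty.nat]))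
        (two .v0 (k.rename (Ren.wk [ECPS.Ty.nat])))) (ECPS.num n) =
      .app W.cps (two (num n : Val Sig [] Ty.nat).cps k) := by
  rw [num_cps]
  exact congrArg₂ (fun v w => ECPS.Comp.app v (two (ECPS.num n) w))
    (ECPS.Val.subst_append_wk W.cps (one (ECPS.num n)))
    (ECPS.Val.subst_append_wk k (one (ECPS.num n)))

/-- The value returned by the unfolding of `fix F`. -/
theorem fixUnfold_cps (F : Val Sig [] (Ty.arr (Ty.arr τ ρ) (Ty.arr τ ρ))) :
    ∃ V : Val Sig [] (Ty.arr τ ρ), fixUnfold F = Comp.ret V ∧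
      V.cps = fixArg τ.cps ρ.cps (F.cps.rename (Ren.wk [_, _, _, _]))
        ((Comp.fix F).cps.rename (Ren.wk [_, _, _, _, _, _, _])) := by
  refine ⟨_, rfl, ?_⟩
  refine Eq.trans (b := fixArg τ.cps ρ.cps
    ((((Val.cps (F.rename (Ren.wk [τ]))).rename _).rename _).rename _)
    ((((((Comp.cps (Comp.fix (F.rename (Ren.wk [τ, τ])))).rename _).rename _).rename _).rename
      _).rename _)) rfl ?_
  have h₁ := Val.cps_rename F (Ren.wk [τ]) (Ren.wk [τ.cps]) (fun _ _ => rfl)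
  have h₂ := Comp.cps_rename (Comp.fix F) (Ren.wk [τ, τ]) (Ren.wk [τ.cps, τ.cps]) (fun _ _ => rfl)
  refine congrArg₂ (fixArg τ.cps ρ.cps) ?_ ?_
  · exact ECPS.Val.eq_of_closed_renaming _ (ECPS.Val.rename_of_closed_renaming _
      (ECPS.Val.rename_of_closed_renaming _ (ECPS.Val.rename_of_closed_renaming _ (⟨_, h₁⟩))))
  · exact ECPS.Val.eq_of_closed_renaming _ (ECPS.Val.rename_of_closed_renaming _
      (ECPS.Val.rename_of_closed_renaming _ (ECPS.Val.rename_of_closed_renaming _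
      (ECPS.Val.rename_of_closed_renaming _ (ECPS.Val.rename_of_closed_renaming _ (⟨_,
      h₂⟩))))))

theorem cps_fix_step₁ (A B : ECPS.Ty)
    (f : ECPS.Val Sig []
      (ECPS.Ty.neg [ECPS.Ty.neg [A, ECPS.Ty.neg [B]],
        ECPS.Ty.neg [ECPS.Ty.neg [A, ECPS.Ty.neg [B]]]]))
    (k : ECPS.Val Sig [] (ECPS.Ty.neg [ECPS.Ty.neg [A, ECPS.Ty.neg [B]]])) :
    ECPS.Step (.app (fixCps A B f) (one k))
      (.mu (fixMuBody A B (f.rename (Ren.wk [_, _, _, _, _, _]))) (one k)) := by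
  rw [fixCps_eq]
  refine (ECPS.Step.beta _ _).trans_eq ?_
  refine Eq.trans (b := ECPS.Comp.mu (fixMuBody A B
    ((f.rename (Ren.wk [_, _, _, _, _, _, _])).subst
      ((ECPS.Subst.append (one k) ECPS.Subst.idn).lifts [_, _, _, _, _, _]))) (one k)) rfl ?_
  rw [ECPS.Val.subst_rename_of_closed]

theorem cps_fix_step₂ (A B : ECPS.Ty)
    (f : ECPS.Val Sig []
      (ECPS.Ty.neg [ECPS.Ty.neg [A, ECPS.Ty.neg [B]],
        ECPS.Ty.neg [ECPS.Ty.neg [A, ECPS.Ty.neg [B]]]]))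
    (k : ECPS.Val Sig [] (ECPS.Ty.neg [ECPS.Ty.neg [A, ECPS.Ty.neg [B]]])) :
    ECPS.Step (.mu (fixMuBody A B (f.rename (Ren.wk [_, _, _, _, _, _]))) (one k))
      (.app (.lam [_] (.app .v0 (.one (fixArg A B (f.rename (Ren.wk [_, _, _, _, _]))
        ((fixCps A B f).rename (Ren.wk [_, _, _, _, _, _, _, _])))))) (one k)) := by
  refine (ECPS.Step.mu _ _).trans_eq ?_
  rw [← fixCps_eq_muVal]
  refine congrArg₂ (fun g m => ECPS.Comp.app (.lam [_] (.app .v0 (.one (fixArg A B g m)))) (one k))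
    (ECPS.Val.subst_rename_of_closed f _ _ _) ?_
  refine Eq.trans (b := ((((((((fixCps A B f).rename _).rename _).rename _).rename _).rename
    _).rename _).rename _).rename _) rfl ?_
  exact ECPS.Val.eq_of_closed_renaming _ (ECPS.Val.rename_of_closed_renaming _
      (ECPS.Val.rename_of_closed_renaming _ (ECPS.Val.rename_of_closed_renaming _
      (ECPS.Val.rename_of_closed_renaming _ (ECPS.Val.rename_of_closed_renaming _
      (ECPS.Val.rename_of_closed_renaming _ (ECPS.Val.rename_of_closed_renaming _ (⟨_,
      rfl⟩))))))))

theorem cps_fix_step₃ (A B : ECPS.Ty)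
    (f : ECPS.Val Sig []
      (ECPS.Ty.neg [ECPS.Ty.neg [A, ECPS.Ty.neg [B]],
        ECPS.Ty.neg [ECPS.Ty.neg [A, ECPS.Ty.neg [B]]]]))
    (m : ECPS.Val Sig [] (ECPS.Ty.neg [ECPS.Ty.neg [ECPS.Ty.neg [A, ECPS.Ty.neg [B]]]]))
    (k : ECPS.Val Sig [] (ECPS.Ty.neg [ECPS.Ty.neg [A, ECPS.Ty.neg [B]]])) :
    ECPS.Step (.app (.lam [_] (.app .v0 (.one (fixArg A B (f.rename (Ren.wk [_, _, _, _, _]))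
        (m.rename (Ren.wk [_, _, _, _, _, _, _, _])))))) (one k))
      (.app k (one (fixArg A B (f.rename (Ren.wk [_, _, _, _]))
        (m.rename (Ren.wk [_, _, _, _, _, _, _]))))) :=
  (ECPS.Step.beta _ _).trans_eq <|
    congrArg₂ (fun g m => ECPS.Comp.app k (one (fixArg A B g m)))
      (ECPS.Val.subst_rename_of_closed f _ _ _) (ECPS.Val.subst_rename_of_closed m _ _ _)

end steps
end EPCF

namespace EffTree

open OmegaCompletePartialOrder

variable {Sig : Type u} {X Y : Type v}

theorem ωSup_label (c : Chain (EffTree Sig X)) (p : List ℕ) :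
    (ωSup c).label p = Label.bot ∨ ∃ n, (ωSup c).label p = (c n).label p := by
  change (chainSup c).label p = _ ∨ ∃ n, (chainSup c).label p = _
  unfold chainSup
  dsimp only
  split_ifs with h
  · exact Or.inr ⟨_, rfl⟩
  · exact Or.inl rfl

theorem node_ωSup_le (σ : Sig) (m : ℕ) (c : Chain (EffTree Sig X))
    (d : ℕ → Chain (EffTree Sig X)) (h : ∀ n, c (n + 1) = node σ m (fun k => d k n)) :
    node σ m (fun k => ωSup (d k)) ≤ ωSup c := by
  intro p
  cases p with
  | nil => exact (h 0 ▸ le_ωSup c 1 :) []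
  | cons i p =>
    rcases ωSup_label (d i) p with hb | ⟨n, hn⟩
    · exact Or.inl hb
    · change (ωSup (d i)).label p = _ ∨ (ωSup (d i)).label p = _
      rw [hn]
      exact (h n ▸ le_ωSup c (n + 1) :) (i :: p)

theorem mapLeaves_mono (f : X → Y) {s t : EffTree Sig X} (h : s ≤ t) :
    s.mapLeaves f ≤ t.mapLeaves f := by
  intro p
  rcases h p with h | h
  · left
    simp only [mapLeaves, h]
  · right
    simp only [mapLeaves, h]

theorem mapLeaves_leaf (f : X → Y) (x : X) :
    (leaf x : EffTree Sig X).mapLeaves f = leaf (f x) := by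
  ext p
  cases p <;> rfl

theorem mapLeaves_node (f : X → Y) (σ : Sig) (m : ℕ) (c : ℕ → EffTree Sig X) :
    (node σ m c).mapLeaves f = node σ m (fun k => (c k).mapLeaves f) := by
  ext p
  cases p <;> rfl

theorem mapLeaves_ωSup_le (f : X → Y) (c : Chain (EffTree Sig X)) {t : EffTree Sig Y}
    (h : ∀ n, (c n).mapLeaves f ≤ t) : (ωSup c).mapLeaves f ≤ t := by
  intro p
  rcases ωSup_label c p with hb | ⟨n, hn⟩
  · left
    simp only [mapLeaves, hb]
  · have hn' : ((ωSup c).mapLeaves f).label p = ((c n).mapLeaves f).label p := by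
      simp only [mapLeaves, hn]
    rw [hn']
    exact h n p

end EffTree

namespace ECPS

variable {Sig : Type u}

theorem approx_le_tree (n : ℕ) (t : Comp Sig []) : approx n t ≤ tree t :=
  OmegaCompletePartialOrder.le_ωSup
    ⟨fun n => approx n t, monotone_nat_of_le_succ (fun n => approx_le_succ n t)⟩ n

theorem tree_le {t : Comp Sig []} {T : EffTree Sig PUnit.{u + 1}} (h : ∀ n, approx n t ≤ T) :
    tree t ≤ T :=
  OmegaCompletePartialOrder.ωSup_le _ _ h

theorem Step.approx_succ {t s : Comp Sig []} (h : Step t s) (n : ℕ) :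
    approx (n + 1) t = approx n s := by
  simp only [approx, (next_eq_some_iff t s).2 h]

theorem Step.tree_eq {t s : Comp Sig []} (h : Step t s) : tree t = tree s := by
  apply le_antisymm
  · exact tree_le fun n =>
      ((approx_le_succ n t).trans (h.approx_succ n).le).trans (approx_le_tree n s)
  · exact tree_le fun n => (h.approx_succ n).ge.trans (approx_le_tree (n + 1) t)

theorem node_tree_le (σ : Sig) (v : Val Sig [] Ty.nat) (s : Comp Sig [Ty.nat]) :
    EffTree.node σ v.toNat (fun k => tree (s.inst (num k))) ≤ tree (Comp.op σ v s) :=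
  EffTree.node_ωSup_le σ v.toNat _
    (fun k => ⟨fun n => approx n (s.inst (num k)),
      monotone_nat_of_le_succ fun n => approx_le_succ n _⟩) fun _ => rfl

/-- `t` has the same tree as `s`, and reaches each part of it strictly later than `s`. -/
def Delays (t s : Comp Sig []) : Prop :=
  tree t = tree s ∧ ∀ n, approx (n + 1) t ≤ approx n s

theorem Step.delays {t s : Comp Sig []} (h : Step t s) : Delays t s :=
  ⟨h.tree_eq, fun n => (h.approx_succ n).le⟩

theorem Delays.step {t s r : Comp Sig []} (h : Delays t s) (h' : Step s r) : Delays t r :=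
  ⟨h.1.trans h'.tree_eq, fun n =>
    ((h.2 n).trans (approx_le_succ n s)).trans (h'.approx_succ n).le⟩

/-- If `t` reaches in at least two steps what `s` reaches in one, then `t` delays `s`. -/
theorem Step.delays_of_step {t t' s r : Comp Sig []} (h : Step t t') (h' : Delays t' r)
    (hs : Step s r) : Delays t s := by
  refine ⟨(h.tree_eq.trans h'.1).trans hs.tree_eq.symm, fun n => ?_⟩
  rw [h.approx_succ]
  cases n with
  | zero => exact bot_le
  | succ n => exact (h'.2 n).trans (hs.approx_succ n).ge

end ECPS

namespace EPCF

variable {Sig : Type u} {ρ : Ty}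

theorem approx_le_tree (n : ℕ) (c : Config Sig ρ) : approx n c ≤ tree c :=
  OmegaCompletePartialOrder.le_ωSup
    ⟨fun n => approx n c, monotone_nat_of_le_succ (fun n => approx_le_succ n c)⟩ n

theorem Step.approx_succ {c d : Config Sig ρ} (h : Step c d) (n : ℕ) :
    approx (n + 1) c = approx n d := by
  simp only [approx, (next_eq_some_iff c d).2 h]

theorem Step.tree_le {c d : Config Sig ρ} (h : Step c d) : tree d ≤ tree c :=
  OmegaCompletePartialOrder.ωSup_le _ _ fun n =>
    (h.approx_succ n).ge.trans (approx_le_tree (n + 1) c)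

theorem approx_succ_op {τ : Ty} (S : Stack Sig [] τ ρ) (σ : Sig) (V : Val Sig [] Ty.nat)
    (W : Val Sig [] (Ty.arr Ty.nat τ)) (n : ℕ) :
    approx (n + 1) ⟨S, Comp.op σ V W⟩ =
      EffTree.node σ V.toNat (fun k => approx n ⟨S, Comp.app W (num k)⟩) := by
  cases S <;> rfl

theorem node_tree_le {τ : Ty} (S : Stack Sig [] τ ρ) (σ : Sig) (V : Val Sig [] Ty.nat)
    (W : Val Sig [] (Ty.arr Ty.nat τ)) :
    EffTree.node σ V.toNat (fun k => tree ⟨S, Comp.app W (num k)⟩) ≤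
      tree ⟨S, Comp.op σ V W⟩ :=
  EffTree.node_ωSup_le σ V.toNat _
    (fun k => ⟨fun n => approx n ⟨S, Comp.app W (num k)⟩,
      monotone_nat_of_le_succ fun n => approx_le_succ n _⟩) (approx_succ_op S σ V W)

theorem progress (c : Config Sig ρ) :
    (∃ d, Step c d) ∨ (∃ V, c = ⟨Stack.id, Comp.ret V⟩) ∨
      ∃ (τ : Ty) (S : Stack Sig [] τ ρ) (σ : Sig) (V : Val Sig [] Ty.nat)
        (W : Val Sig [] (Ty.arr Ty.nat τ)), c = ⟨S, Comp.op σ V W⟩ := by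
  obtain ⟨S, M⟩ := c
  cases M with
  | app V W =>
    cases V with
    | var x => cases x
    | lam M => exact Or.inl ⟨_, Step.red S _ _ (Red.beta M W)⟩
  | ret V =>
    cases S with
    | id => exact Or.inr (Or.inl ⟨V, rfl⟩)
    | push S M => exact Or.inl ⟨_, Step.pop S M V⟩
  | letin M N => exact Or.inl ⟨_, Step.push S M N⟩
  | fix F => exact Or.inl ⟨_, Step.red S _ _ (Red.fix F)⟩
  | natCase V M N =>
    cases V with
    | var x => cases x
    | zero => exact Or.inl ⟨_, Step.red S _ _ (Red.caseZero M N)⟩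
    | succ V => exact Or.inl ⟨_, Step.red S _ _ (Red.caseSucc V M N)⟩
  | op σ V W => exact Or.inr (Or.inr ⟨_, S, σ, V, W, rfl⟩)

/-- The translation `M* S*` of a configuration `(S, M)`. -/
def Config.cps (c : Config Sig ρ) : ECPS.Comp Sig [] :=
  ECPS.Comp.app c.comp.cps (ECPS.Args.one c.stack.cps)

theorem Red.cps_delays {τ : Ty} {M N : Comp Sig [] τ} (h : Red M N)
    (k : ECPS.Val Sig [] (ECPS.Ty.neg [τ.cps])) :
    ECPS.Delays (.app M.cps (.one k)) (.app N.cps (.one k)) := by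
  cases h with
  | beta M V =>
    rw [Comp.cps_inst]
    exact (cps_app_step (Val.lam M) V k).delays.step (cps_lam_step M V.cps k)
  | fix F =>
    obtain ⟨V, hV, hV'⟩ := fixUnfold_cps F
    have h := cps_ret_step V k
    rw [hV'] at h
    rw [hV]
    exact (cps_fix_step₁ _ _ F.cps k).delays_of_step
      ((cps_fix_step₂ _ _ F.cps k).delays.step (cps_fix_step₃ _ _ F.cps _ k)) h
  | caseZero _ N =>
    exact (cps_natCase_step Val.zero _ N k).delays.step (ECPS.Step.caseZero _ _)
  | caseSucc V _ N =>
    rw [Comp.cps_inst]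
    exact (cps_natCase_step (Val.succ V) _ N k).delays.step (cps_caseSucc_step V _ N k)

theorem Step.cps_delays {c d : Config Sig ρ} (h : Step c d) : ECPS.Delays c.cps d.cps := by
  cases h with
  | push S N M => exact (cps_letin_step N M S.cps).delays
  | pop S M V =>
    unfold Config.cps
    rw [Comp.cps_inst]
    exact (cps_ret_step V _).delays.step (cps_push_step M V.cps S.cps)
  | red S M N h => exact h.cps_delays S.cps

theorem cps_id_ret_step (V : Val Sig [] ρ) :
    ∃ t, ECPS.Step (Config.cps ⟨Stack.id, Comp.ret V⟩) t ∧ ECPS.Step t ECPS.Comp.down :=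
  ⟨_, cps_ret_step V _, ECPS.Step.beta (As := [ρ.cps]) ECPS.Comp.down (.one V.cps)⟩

theorem mapLeaves_approx_le (n : ℕ) : ∀ c : Config Sig ρ,
    (approx n c).mapLeaves (fun _ => PUnit.unit) ≤ ECPS.tree c.cps := by
  induction n with
  | zero => intro c p; exact Or.inl rfl
  | succ n ih =>
    intro c
    rcases progress c with ⟨d, h⟩ | ⟨V, rfl⟩ | ⟨τ, S, σ, V, W, rfl⟩
    · rw [h.approx_succ, h.cps_delays.1]
      exact ih d
    · obtain ⟨t, h₁, h₂⟩ := cps_id_ret_step V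
      rw [h₁.tree_eq, h₂.tree_eq]
      exact (EffTree.mapLeaves_leaf _ V).le.trans (ECPS.approx_le_tree 1 ECPS.Comp.down)
    · rw [approx_succ_op, EffTree.mapLeaves_node, Config.cps, (cps_op_step σ V W S.cps).tree_eq,
        ← toNat_cps]
      refine le_trans (EffTree.node_mono _ _ fun k => ?_) (ECPS.node_tree_le σ V.cps _)
      refine (ih ⟨S, Comp.app W (num k)⟩).trans ?_
      exact (cps_app_step W (num k) S.cps).tree_eq.le.trans
        (congrArg ECPS.tree (cps_op_child W S.cps k)).ge

theorem approx_cps_le (n : ℕ) : ∀ c : Config Sig ρ,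
    ECPS.approx n c.cps ≤ (tree c).mapLeaves (fun _ => PUnit.unit) := by
  induction n with
  | zero => intro c; exact bot_le
  | succ n ih =>
    intro c
    rcases progress c with ⟨d, h⟩ | ⟨V, rfl⟩ | ⟨τ, S, σ, V, W, rfl⟩
    · exact ((h.cps_delays.2 n).trans (ih d)).trans (EffTree.mapLeaves_mono _ h.tree_le)
    · obtain ⟨t, h₁, h₂⟩ := cps_id_ret_step V
      refine le_trans ?_ (EffTree.mapLeaves_mono _ (approx_le_tree 1 _))
      refine le_trans ?_ (EffTree.mapLeaves_leaf _ V).ge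
      rw [h₁.approx_succ]
      cases n with
      | zero => exact bot_le
      | succ n =>
        rw [h₂.approx_succ]
        cases n with
        | zero => exact bot_le
        | succ n => exact le_rfl
    · refine le_trans ?_ (EffTree.mapLeaves_mono _ (node_tree_le S σ V W))
      rw [EffTree.mapLeaves_node, Config.cps, (cps_op_step σ V W S.cps).approx_succ, ← toNat_cps]
      cases n with
      | zero => exact bot_le
      | succ n =>
        refine EffTree.node_mono _ _ fun k => ?_
        refine le_trans ?_ (ih ⟨S, Comp.app W (num k)⟩)
        exact (congrArg (ECPS.approx n) (cps_op_child W S.cps k)).le.trans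
          ((cps_app_step W (num k) S.cps).approx_succ n).ge

end EPCF

theorem mainTheorem5 {Sig : Type u} {τ ρ : EPCF.Ty}
    (M : EPCF.Comp Sig [] τ) (S : EPCF.Stack Sig [] τ ρ) :
    ECPS.tree (ECPS.Comp.app M.cps (ECPS.Args.one S.cps)) =
      (EPCF.tree ⟨S, M⟩).mapLeaves (fun _ => PUnit.unit) :=
  le_antisymm (ECPS.tree_le fun n => EPCF.approx_cps_le n ⟨S, M⟩)
    (EffTree.mapLeaves_ωSup_le _ _ fun n => EPCF.mapLeaves_approx_le n ⟨S, M⟩)
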